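/- Theorem 1.3. Let $\Pi^4_{12}\subset\mathbb{Z}^2\subset\mathbb{R}^2$ be the set of all pairs $(f_1(P),f_2(P))$, where $P$ ranges over the $4$-dimensional convex polytopes and $f_k(P)$ denotes the number of $k$-dimensional faces of $P$ (so $f_1$ and $f_2$ are the numbers of edges and of ridges). Then $\Pi^4_{12}$ is not an $\mathbb{R}$-semi-algebraic set of lattice points; that is, there are no semi-algebraic set $S\subseteq\mathbb{R}^2$ and affine lattice $\Lambda\subset\mathbb{R}^2$ such that $\Pi^4_{12}=S\cap\Lambda$. Here a semi-algebraic set is a finite union of sets each of which is defined by finitely many polynomial equations and (strict or non-strict) inequalities with real coefficients, and an affine lattice is a translate of a discrete additive subgroup of $\mathbb{R}^2$. -/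

import Mathlib

/-- A basic semi-algebraic set in `ℝ^d`: the solution set of finitely many real polynomial
equations, non-strict inequalities and strict inequalities. -/
def IsBasicSemialgebraic {d : ℕ} (S : Set (Fin d → ℝ)) : Prop :=
  ∃ E N P : Finset (MvPolynomial (Fin d) ℝ),
    S = {x | (∀ p ∈ E, MvPolynomial.eval x p = 0) ∧
             (∀ p ∈ N, 0 ≤ MvPolynomial.eval x p) ∧
             (∀ p ∈ P, 0 < MvPolynomial.eval x p)}

/-- An `ℝ`-semi-algebraic set: a finite union of basic semi-algebraic sets. -/
def IsSemialgebraic {d : ℕ} (S : Set (Fin d → ℝ)) : Prop :=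
  ∃ B : Set (Set (Fin d → ℝ)), B.Finite ∧ (∀ T ∈ B, IsBasicSemialgebraic T) ∧ S = ⋃₀ B

/-- An affine lattice in `ℝ^d`: a translate of a discrete additive subgroup
(not necessarily of full rank). -/
def IsAffineLattice {d : ℕ} (Λ : Set (Fin d → ℝ)) : Prop :=
  ∃ (v : Fin d → ℝ) (L : AddSubgroup (Fin d → ℝ)),
    DiscreteTopology L ∧ Λ = {x | ∃ y ∈ L, x = v + y}

/-- An `ℝ`-semi-algebraic set of lattice points: the intersection of a semi-algebraic set with
an affine lattice. -/
def IsSemialgebraicLatticePointSet {d : ℕ} (A : Set (Fin d → ℝ)) : Prop :=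
  ∃ S Λ : Set (Fin d → ℝ), IsSemialgebraic S ∧ IsAffineLattice Λ ∧ A = S ∩ Λ

/-- A `d`-dimensional (convex) polytope, realized in `ℝ^d`: the convex hull of a finite set of
points, of dimension `d`. -/
def IsFullDimPolytope (d : ℕ) (P : Set (Fin d → ℝ)) : Prop :=
  (∃ V : Finset (Fin d → ℝ), P = convexHull ℝ (V : Set (Fin d → ℝ))) ∧
    P.Nonempty ∧ Module.finrank ℝ (vectorSpan ℝ P) = d

/-- The `k`-dimensional faces of `P`. A nonempty face is the set of maximizers over `P` of a linear
functional; its dimension is that of its affine hull. -/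
def kFaces {d : ℕ} (P : Set (Fin d → ℝ)) (k : ℕ) : Set (Set (Fin d → ℝ)) :=
  {F | F.Nonempty ∧ IsExposed ℝ P F ∧ Module.finrank ℝ (vectorSpan ℝ F) = k}

/-- The face number `f_k(P)`, for a polytope `P` (which has only finitely many faces). -/
noncomputable def faceNumber {d : ℕ} (P : Set (Fin d → ℝ)) (k : ℕ) : ℕ :=
  (kFaces P k).ncard

/-- The set `F^d` of all `f`-vectors `(f_0, …, f_{d-1})` of `d`-dimensional polytopes, as a set of
points of `ℝ^d`. -/
def fVectorSet (d : ℕ) : Set (Fin d → ℝ) :=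
  {f | ∃ P : Set (Fin d → ℝ), IsFullDimPolytope d P ∧ ∀ k : Fin d, f k = (faceNumber P k : ℝ)}

/-- The projection `Π^d_{ij}` of `F^d` to the coordinates `i` and `j`: the set of all pairs
`(f_i, f_j)` of `d`-dimensional polytopes, as a subset of `ℝ^2`. -/
def facePairSet (d : ℕ) (i j : Fin d) : Set (Fin 2 → ℝ) :=
  (fun f : Fin d → ℝ => ![f i, f j]) '' fVectorSet d

/-! Every 4-polytope satisfies f₂ ≤ 2(f₁ − f₀) and f₁ ≤ C(f₀, 2)
(`IsFullDimPolytope.faceNumber_le`). The first is the bound "at most 3n − 6 edges" for 3-polytopes,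
summed over all vertex figures; it is an equality for simplicial polytopes. A pair with f₂ close to
2f₁ therefore forces few vertices, and few vertices allow few edges.

Consider the curve γ(t) = (8t² + 13t + 6, 16t² + 18t + 4). At an integer t = l ≥ 2 it passes through
the pair of a simplicial polytope with 4l + 4 vertices and exactly l missing edges
(`mem_facePairSet`). At t = l + 3/8 it passes through another integer point, which is not realized:
at most 4l + 5 vertices are available, too few for that many edges (`notMem_facePairSet`). A
polynomial in one variable has eventually constant sign, so γ finally stays inside or outside any
semi-algebraic set (`IsSemialgebraic.eventuallyDecided`). Nor can the lattice remove the bad points: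
the differences of four realized pairs generate ℤ² (`IsAffineLattice.intCast_mem`). Pairs on γ at
integers have even f₂, so one of the four, from a pyramid over a triangular bipyramid, lies off the
curve.

For the inequalities, polytopes are homogenized: faces become zero sets of nonnegative functionals,
dimension k becomes rank k + 1, and vertex figures become quotients (`contract`). Euler's relation
in rank four comes from a generic height function (`euler_rank_four`).

The simplicial polytope has vertices on the moment curve at −1, 1 and l, …, 5l, and an apex (0, 0,
0, h) with h = 4l² − 1/2. A functional is a quartic p, whose value at the apex is p(0) + h ·
(leading coefficient). Squares of quadratics show that all pairs on the curve are edges. Explicit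
quartics join the apex to ±1 and to every a ≥ 2l, while an interpolation identity with positive
coefficients excludes l ≤ a < 2l. -/

/-! ### Vector configurations and their faces

A configuration is a finite family `v i`, `i ∈ s`, of vectors of a real vector space. Its faces are
the zero sets in `s` of the linear functionals that are nonnegative on the family. -/

namespace VectorConfig

open Module Submodule
open scoped Classical

variable {ι V : Type*} [AddCommGroup V] [Module ℝ V]

/-- The dimension of the span of the vectors with index in `F`. -/
noncomputable def rank (v : ι → V) (F : Finset ι) : ℕ :=
  finrank ℝ (span ℝ (v '' F))

/-- `φ` is nonnegative on the family, and vanishes exactly at the indices in `F`. -/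
def Supports (v : ι → V) (s F : Finset ι) (φ : Dual ℝ V) : Prop :=
  ∀ i ∈ s, 0 ≤ φ (v i) ∧ (φ (v i) = 0 ↔ i ∈ F)

/-- `F` is a face of the configuration `v i`, `i ∈ s`. -/
def IsFace (v : ι → V) (s F : Finset ι) : Prop :=
  F ⊆ s ∧ ∃ φ : Dual ℝ V, Supports v s F φ

/-- `φ` is positive on all nonzero vectors of the family. -/
def IsPositive (v : ι → V) (s : Finset ι) (φ : Dual ℝ V) : Prop :=
  ∀ i ∈ s, v i ≠ 0 → 0 < φ (v i)

/-- The family generates a pointed cone. -/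
def IsPointed (v : ι → V) (s : Finset ι) : Prop :=
  ∃ φ : Dual ℝ V, IsPositive v s φ

/-- The faces of rank `r`. -/
noncomputable def faces (v : ι → V) (s : Finset ι) (r : ℕ) : Finset (Finset ι) :=
  s.powerset.filter fun F => IsFace v s F ∧ rank v F = r

theorem mem_faces {v : ι → V} {s F : Finset ι} {r : ℕ} :
    F ∈ faces v s r ↔ IsFace v s F ∧ rank v F = r := by
  simp only [faces, Finset.mem_filter, Finset.mem_powerset]
  exact ⟨fun h => h.2, fun h => ⟨h.1.1, h⟩⟩

instance (v : ι → V) (F : Finset ι) : FiniteDimensional ℝ (span ℝ (v '' (F : Set ι))) :=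
  FiniteDimensional.span_of_finite ℝ (F.finite_toSet.image v)

theorem mem_span {v : ι → V} {F : Finset ι} {i : ι} (h : i ∈ F) :
    v i ∈ span ℝ (v '' (F : Set ι)) :=
  subset_span ⟨i, h, rfl⟩

theorem span_le_ker {v : ι → V} {F : Finset ι} {W : Type*} [AddCommGroup W] [Module ℝ W]
    {φ : V →ₗ[ℝ] W}
    (h : ∀ i ∈ F, φ (v i) = 0) : span ℝ (v '' (F : Set ι)) ≤ LinearMap.ker φ := by
  rw [span_le]
  rintro _ ⟨i, hi, rfl⟩
  exact h i hi

theorem rank_mono {v : ι → V} {F G : Finset ι} (h : F ⊆ G) : rank v F ≤ rank v G :=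
  Submodule.finrank_mono (span_mono (Set.image_mono (by exact_mod_cast h)))

theorem Supports.zero_of_mem {v : ι → V} {s F : Finset ι} {φ : Dual ℝ V} (h : Supports v s F φ)
    (hF : F ⊆ s) {i : ι} (hi : i ∈ F) : φ (v i) = 0 :=
  ((h i (hF hi)).2).2 hi

theorem Supports.pos_of_notMem {v : ι → V} {s F : Finset ι} {φ : Dual ℝ V} (h : Supports v s F φ)
    {i : ι} (hs : i ∈ s) (hi : i ∉ F) : 0 < φ (v i) :=
  lt_of_le_of_ne (h i hs).1 fun e => hi ((h i hs).2.1 e.symm)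

theorem IsFace.mem_of_mem_span {v : ι → V} {s F : Finset ι} (h : IsFace v s F) {i : ι}
    (hs : i ∈ s) (hi : v i ∈ span ℝ (v '' (F : Set ι))) : i ∈ F := by
  obtain ⟨hF, φ, hφ⟩ := h
  have := span_le_ker (fun i hi => hφ.zero_of_mem hF hi) hi
  exact (hφ i hs).2.1 this

theorem isFace_self (v : ι → V) (s : Finset ι) : IsFace v s s :=
  ⟨subset_rfl, 0, fun i hi => ⟨le_rfl, by simp [hi]⟩⟩

theorem IsFace.eq_of_subset_of_rank_le {v : ι → V} {s F G : Finset ι} (hF : IsFace v s F)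
    (hG : G ⊆ s) (hFG : F ⊆ G) (hr : rank v G ≤ rank v F) : F = G := by
  refine subset_antisymm hFG fun i hi => hF.mem_of_mem_span (hG hi) ?_
  have hle : span ℝ (v '' (F : Set ι)) ≤ span ℝ (v '' (G : Set ι)) :=
    span_mono (Set.image_mono (by exact_mod_cast hFG))
  rw [Submodule.eq_of_le_of_finrank_le hle hr]
  exact mem_span hi

theorem IsFace.inter {v : ι → V} {s F G : Finset ι} (hF : IsFace v s F) (hG : IsFace v s G) :
    IsFace v s (F ∩ G) := by
  obtain ⟨hF, φ, hφ⟩ := hF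
  obtain ⟨hG, ψ, hψ⟩ := hG
  refine ⟨Finset.inter_subset_left.trans hF, φ + ψ, fun i hi => ?_⟩
  obtain ⟨a, b⟩ := hφ i hi
  obtain ⟨c, d⟩ := hψ i hi
  refine ⟨add_nonneg a c, ?_⟩
  rw [Finset.mem_inter, ← b, ← d]
  simp only [LinearMap.add_apply]
  exact add_eq_zero_iff_of_nonneg a c

theorem IsFace.of_subset {v : ι → V} {s F G : Finset ι} (hG : IsFace v s G) (hF : F ⊆ s)
    (hGF : G ⊆ F) : IsFace v F G := by
  obtain ⟨-, φ, hφ⟩ := hG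
  exact ⟨hGF, φ, fun i hi => hφ i (hF hi)⟩

/-- A large multiple of the functional of `F` dominates the functional of `G` at the finitely many
indices outside `F`, and it vanishes on `F`. -/
theorem IsFace.trans {v : ι → V} {s F G : Finset ι} (hF : IsFace v s F) (hG : IsFace v F G) :
    IsFace v s G := by
  obtain ⟨hF, φ, hφ⟩ := hF
  obtain ⟨hGF, ψ, hψ⟩ := hG
  obtain ⟨K, hK0, hK⟩ : ∃ K : ℝ, 0 < K ∧ ∀ i ∈ s, i ∉ F → 0 < K * φ (v i) + ψ (v i) := by
    have h1 : ∀ i ∈ s, i ∉ F → ∃ K : ℝ, ∀ L ≥ K, 0 < L * φ (v i) + ψ (v i) := by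
      intro i hi hiF
      have hp := hφ.pos_of_notMem hi hiF
      refine ⟨(1 - ψ (v i)) / φ (v i), fun L hL => ?_⟩
      rw [ge_iff_le, div_le_iff₀ hp] at hL
      linarith
    choose! c hc using h1
    obtain ⟨M, hM⟩ := (s.image c).bddAbove
    refine ⟨max M 1, by positivity, fun i hi hiF => hc i hi hiF _ ?_⟩
    exact (hM (by simpa using ⟨i, hi, rfl⟩)).trans (le_max_left _ _)
  refine ⟨hGF.trans hF, K • φ + ψ, fun i hi => ?_⟩
  simp only [LinearMap.add_apply, LinearMap.smul_apply, smul_eq_mul]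
  by_cases hiF : i ∈ F
  · rw [hφ.zero_of_mem hF hiF]
    simpa using hψ i hiF
  · have := hK i hi hiF
    exact ⟨this.le, fun e => absurd e this.ne', fun e => absurd (hGF e) hiF⟩

theorem faces_of_isFace {v : ι → V} {s F : Finset ι} (hF : IsFace v s F) (r : ℕ) :
    faces v F r = (faces v s r).filter (· ⊆ F) := by
  ext G
  simp only [Finset.mem_filter, mem_faces]
  exact ⟨fun h => ⟨⟨hF.trans h.1, h.2⟩, h.1.1⟩, fun h => ⟨h.1.1.of_subset hF.1 h.2, h.1.2⟩⟩

/-! ### Contraction -/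

/-- The image of the configuration modulo the span of `A`. -/
def contract (v : ι → V) (A : Finset ι) : ι → V ⧸ span ℝ (v '' (A : Set ι)) :=
  fun i => mkQ _ (v i)

/-- Functionals on the quotient are the functionals that vanish on `A`. The members of `A` remain in
the index set as zero vectors, so every face of the contraction contains them; this is why
configurations may contain zero vectors. -/
theorem isFace_contract_iff {v : ι → V} {s A F : Finset ι} (hA : IsFace v s A) :
    IsFace (contract v A) s F ↔ IsFace v s F ∧ A ⊆ F := by
  constructor
  · rintro ⟨hF, φ, hφ⟩
    refine ⟨⟨hF, φ.comp (mkQ _), fun i hi => hφ i hi⟩, fun i hi => (hφ i (hA.1 hi)).2.1 ?_⟩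
    have : contract v A i = 0 := by
      simpa [contract] using mem_span hi
    rw [this, map_zero]
  · rintro ⟨⟨hF, φ, hφ⟩, hAF⟩
    refine ⟨hF, liftQ _ φ (span_le_ker fun i hi => hφ.zero_of_mem hF (hAF hi)), fun i hi => ?_⟩
    simpa [contract] using hφ i hi

theorem rank_contract (v : ι → V) {A F : Finset ι} (hAF : A ⊆ F) :
    rank (contract v A) F + rank v A = rank v F := by
  have h1 : span ℝ (contract v A '' (F : Set ι)) =
      (span ℝ (v '' (F : Set ι))).map (mkQ (span ℝ (v '' (A : Set ι)))) := by
    rw [map_span, ← Set.image_comp]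
    rfl
  have hle : span ℝ (v '' (A : Set ι)) ≤ span ℝ (v '' (F : Set ι)) :=
    span_mono (Set.image_mono (by exact_mod_cast hAF))
  unfold rank
  rw [h1]
  set p := span ℝ (v '' (A : Set ι))
  set q := span ℝ (v '' (F : Set ι))
  have h2 := LinearMap.finrank_range_add_finrank_ker ((mkQ p).domRestrict q)
  rw [LinearMap.range_domRestrict] at h2
  rw [← h2]
  congr 1
  have h3 : LinearMap.ker ((mkQ p).domRestrict q) = p.comap q.subtype := by
    ext x
    simp
  rw [h3]
  exact (LinearEquiv.finrank_eq (Submodule.comapSubtypeEquivOfLe hle)).symm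

theorem faces_contract {v : ι → V} {s A : Finset ι} (hA : IsFace v s A) (r : ℕ) :
    faces (contract v A) s r = (faces v s (r + rank v A)).filter (A ⊆ ·) := by
  ext F
  simp only [Finset.mem_filter, mem_faces, isFace_contract_iff hA]
  constructor
  · rintro ⟨⟨h1, h2⟩, h3⟩
    exact ⟨⟨h1, by rw [← rank_contract v h2, h3]⟩, h2⟩
  · rintro ⟨⟨h1, h3⟩, h2⟩
    refine ⟨⟨h1, h2⟩, ?_⟩
    have := rank_contract v h2
    omega

theorem isPointed_contract {v : ι → V} {s A : Finset ι} (hA : IsFace v s A) :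
    IsPointed (contract v A) s := by
  obtain ⟨hAs, φ, hφ⟩ := hA
  refine ⟨liftQ _ φ (span_le_ker fun i hi => hφ.zero_of_mem hAs hi), fun i hi hne => ?_⟩
  have : i ∉ A := fun h => hne (by simpa [contract] using mem_span h)
  simpa [contract] using hφ.pos_of_notMem hi this

theorem IsPositive.mono {v : ι → V} {s F : Finset ι} {φ : Dual ℝ V} (h : IsPositive v s φ)
    (hF : F ⊆ s) : IsPositive v F φ := fun i hi => h i (hF hi)

theorem IsPointed.mono {v : ι → V} {s F : Finset ι} (h : IsPointed v s)
    (hF : F ⊆ s) : IsPointed v F := h.imp fun _ h => h.mono hF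

theorem rank_pos {v : ι → V} {F : Finset ι} {i : ι} (hi : i ∈ F) (h0 : v i ≠ 0) :
    1 ≤ rank v F := by
  unfold rank
  rw [Nat.one_le_iff_ne_zero, ne_eq, Submodule.finrank_eq_zero]
  intro e
  have := mem_span (v := v) hi
  rw [e] at this
  exact h0 (by simpa using this)

theorem exists_ne_zero_of_rank_pos {v : ι → V} {F : Finset ι} (h : 1 ≤ rank v F) :
    ∃ i ∈ F, v i ≠ 0 := by
  by_contra! hc
  have : span ℝ (v '' (F : Set ι)) = ⊥ := by
    rw [span_eq_bot]
    rintro _ ⟨i, hi, rfl⟩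
    exact hc i hi
  unfold rank at h
  rw [this, finrank_bot] at h
  omega

theorem rank_le_one_of_forall {v : ι → V} {F : Finset ι} {x : V}
    (h : ∀ i ∈ F, v i ∈ span ℝ {x}) : rank v F ≤ 1 := by
  have : span ℝ (v '' (F : Set ι)) ≤ span ℝ {x} := by
    rw [span_le]
    rintro _ ⟨i, hi, rfl⟩
    exact h i hi
  exact (Submodule.finrank_mono this).trans
    (by simpa using finrank_span_le_card (R := ℝ) ({x} : Set V))

theorem mem_span_singleton_of_rank_one {v : ι → V} {F : Finset ι} (hF : rank v F = 1) {i k : ι}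
    (hi : i ∈ F) (h0 : v i ≠ 0) (hk : k ∈ F) : v k ∈ span ℝ {v i} := by
  have hle : span ℝ {v i} ≤ span ℝ (v '' (F : Set ι)) := by
    rw [span_singleton_le_iff_mem]
    exact mem_span hi
  have : span ℝ {v i} = span ℝ (v '' (F : Set ι)) := by
    refine Submodule.eq_of_le_of_finrank_eq hle ?_
    rw [finrank_span_singleton h0]
    exact hF.symm
  rw [this]
  exact mem_span hk

/-- A face that contains the nonzero vector `i` of a face of rank one contains that face. -/
theorem subset_of_rank_one {v : ι → V} {s A F : Finset ι} (hA : A ⊆ s) (hA1 : rank v A = 1)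
    (hF : IsFace v s F) {i : ι} (hi : i ∈ A) (h0 : v i ≠ 0) (hiF : i ∈ F) : A ⊆ F := by
  intro k hk
  refine hF.mem_of_mem_span (hA hk) ?_
  exact (span_mono (by simpa using ⟨i, hiF, rfl⟩))
    (mem_span_singleton_of_rank_one hA1 hi h0 hk)

theorem eq_of_rank_one {v : ι → V} {s A B : Finset ι} (hA : A ∈ faces v s 1)
    (hB : B ∈ faces v s 1) {i : ι} (hi : i ∈ A) (h0 : v i ≠ 0) (hiB : i ∈ B) : A = B := by
  rw [mem_faces] at hA hB
  exact subset_antisymm (subset_of_rank_one hA.1.1 hA.2 hB.1 hi h0 hiB)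
    (subset_of_rank_one hB.1.1 hB.2 hA.1 hiB h0 hi)

end VectorConfig

/-! ### Extremal rank one faces with respect to a generic functional -/

namespace VectorConfig

open Module Submodule
open scoped Classical

variable {ι V : Type*} [AddCommGroup V] [Module ℝ V]

/-- The functional whose sign compares the height `h / φ` of a vector with that of `v i`. -/
def heightDiff (v : ι → V) (φ h : Dual ℝ V) (i : ι) : Dual ℝ V :=
  φ (v i) • h - h (v i) • φ

theorem heightDiff_apply (v : ι → V) (φ h : Dual ℝ V) (i : ι) (x : V) :
    heightDiff v φ h i x = φ (v i) * h x - h (v i) * φ x := by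
  simp [heightDiff]

/-- Vectors of the same height `h / φ` are parallel. -/
def IsGeneric (v : ι → V) (s : Finset ι) (φ h : Dual ℝ V) : Prop :=
  ∀ i ∈ s, ∀ k ∈ s, heightDiff v φ h i (v k) = 0 → φ (v i) • v k = φ (v k) • v i

theorem IsGeneric.mono {v : ι → V} {s F : Finset ι} {φ h : Dual ℝ V} (hg : IsGeneric v s φ h)
    (hF : F ⊆ s) : IsGeneric v F φ h := fun i hi k hk => hg i (hF hi) k (hF hk)

/-- The height difference of two vectors is `h` applied to `w`; over ℝ some functional is nonzero at
all of the finitely many nonzero `w`. -/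
theorem exists_isGeneric (v : ι → V) (s : Finset ι) (φ : Dual ℝ V) : ∃ h, IsGeneric v s φ h := by
  let w : ι × ι → V := fun p => φ (v p.1) • v p.2 - φ (v p.2) • v p.1
  let T := {p : ι × ι // p ∈ s ×ˢ s ∧ w p ≠ 0}
  have : Finite T := Set.Finite.subset (s ×ˢ s).finite_toSet fun p hp => hp.1
  obtain ⟨h, hh⟩ := Module.exists_dual_forall_apply_ne_zero (K := ℝ) (fun p : T => w p.1)
    fun p => p.2.2
  refine ⟨h, fun i hi k hk e => ?_⟩
  by_contra hne
  refine hh ⟨(i, k), by simp [hi, hk], sub_ne_zero.2 hne⟩ ?_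
  rw [heightDiff_apply] at e
  simp only [w, map_sub, map_smul, smul_eq_mul]
  linarith

theorem IsPositive.apply_nonneg {v : ι → V} {s : Finset ι} {φ : Dual ℝ V} (h : IsPositive v s φ)
    {i : ι} (hi : i ∈ s) : 0 ≤ φ (v i) := by
  by_cases h0 : v i = 0
  · simp [h0]
  · exact (h i hi h0).le

/-- Relative to the height function, `F` has points strictly below and strictly above `A`. -/
def Crosses (v : ι → V) (φ h : Dual ℝ V) (A F : Finset ι) : Prop :=
  ∃ i ∈ A, (∃ k ∈ F, heightDiff v φ h i (v k) < 0) ∧ ∃ l ∈ F, 0 < heightDiff v φ h i (v l)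

/-- The members of `A` are nonnegative multiples of `v i`, so the witness in `Crosses` may be any
nonzero member of `A`. -/
theorem crosses_iff {v : ι → V} {s A F : Finset ι} {φ h : Dual ℝ V} (hφ : IsPositive v s φ)
    (hA : A ⊆ s) (hA1 : rank v A = 1) {i : ι} (hi : i ∈ A) (h0 : v i ≠ 0) :
    Crosses v φ h A F ↔
      (∃ k ∈ F, heightDiff v φ h i (v k) < 0) ∧ ∃ l ∈ F, 0 < heightDiff v φ h i (v l) := by
  refine ⟨?_, fun H => ⟨i, hi, H⟩⟩
  rintro ⟨j, hj, ⟨k, hk, hk'⟩, l, hl, hl'⟩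
  obtain ⟨c, hc⟩ := mem_span_singleton.1 (mem_span_singleton_of_rank_one hA1 hi h0 hj)
  have hD : ∀ x, heightDiff v φ h j x = c * heightDiff v φ h i x := by
    intro x
    simp only [heightDiff_apply, ← hc, map_smul, smul_eq_mul]
    ring
  have hp := hφ i (hA hi) h0
  have hc0 : 0 ≤ c := by
    have := hφ.apply_nonneg (hA hj)
    rw [← hc, map_smul, smul_eq_mul] at this
    exact nonneg_of_mul_nonneg_left this hp
  rw [hD] at hk' hl'
  exact ⟨⟨k, hk, by by_contra! hn; nlinarith⟩, ⟨l, hl, pos_of_mul_pos_right hl' hc0⟩⟩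

theorem heightDiff_eq_zero_of_mem {v : ι → V} {A : Finset ι} (φ h : Dual ℝ V)
    (hA1 : rank v A = 1) {i : ι} (hi : i ∈ A) (h0 : v i ≠ 0) {j : ι} (hj : j ∈ A) :
    heightDiff v φ h i (v j) = 0 := by
  obtain ⟨c, hc⟩ := mem_span_singleton.1 (mem_span_singleton_of_rank_one hA1 hi h0 hj)
  simp only [heightDiff_apply, ← hc, map_smul, smul_eq_mul]
  ring

theorem heightDiff_swap (v : ι → V) (φ h : Dual ℝ V) (i k : ι) :
    heightDiff v φ h i (v k) = - heightDiff v φ h k (v i) := by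
  simp only [heightDiff_apply]
  ring

theorem exists_lowest {v : ι → V} {s : Finset ι} {φ : Dual ℝ V} (h : Dual ℝ V)
    (hφ : IsPositive v s φ) (hs : ∃ i ∈ s, v i ≠ 0) :
    ∃ i ∈ s, v i ≠ 0 ∧ ∀ k ∈ s, 0 ≤ heightDiff v φ h i (v k) := by
  obtain ⟨i₀, hi₀, h₀⟩ := hs
  obtain ⟨i, hi, hmin⟩ := Finset.exists_min_image (s.filter fun i => v i ≠ 0)
    (fun i => h (v i) / φ (v i)) ⟨i₀, by simp [hi₀, h₀]⟩
  rw [Finset.mem_filter] at hi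
  refine ⟨i, hi.1, hi.2, fun k hk => ?_⟩
  by_cases hk0 : v k = 0
  · simp [hk0]
  · have := hmin k (by simp [hk, hk0])
    rw [div_le_div_iff₀ (hφ i hi.1 hi.2) (hφ k hk hk0)] at this
    rw [heightDiff_apply]
    linarith

theorem heightDiff_neg (v : ι → V) (φ h : Dual ℝ V) (i : ι) (x : V) :
    heightDiff v φ (-h) i x = - heightDiff v φ h i x := by
  simp only [heightDiff_apply, LinearMap.neg_apply]
  ring

theorem IsGeneric.neg {v : ι → V} {s : Finset ι} {φ h : Dual ℝ V} (hg : IsGeneric v s φ h) :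
    IsGeneric v s φ (-h) := by
  intro i hi k hk e
  rw [heightDiff_neg, neg_eq_zero] at e
  exact hg i hi k hk e

theorem IsGeneric.mem_span {v : ι → V} {s : Finset ι} {φ h : Dual ℝ V} (hφ : IsPositive v s φ)
    (hg : IsGeneric v s φ h) {i k : ι} (hi : i ∈ s) (h0 : v i ≠ 0) (hk : k ∈ s)
    (e : heightDiff v φ h i (v k) = 0) : v k ∈ span ℝ {v i} := by
  have := hg i hi k hk e
  have hp := (hφ i hi h0).ne'
  rw [mem_span_singleton]
  refine ⟨(φ (v i))⁻¹ * φ (v k), ?_⟩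
  rw [mul_smul, ← this, smul_smul, inv_mul_cancel₀ hp, one_smul]

/-- A lowest vector spans a rank one face. -/
theorem exists_face_of_lowest {v : ι → V} {s : Finset ι} {φ h : Dual ℝ V} (hφ : IsPositive v s φ)
    (hg : IsGeneric v s φ h) {i : ι} (hi : i ∈ s) (h0 : v i ≠ 0)
    (hl : ∀ k ∈ s, 0 ≤ heightDiff v φ h i (v k)) : ∃ A ∈ faces v s 1, i ∈ A := by
  refine ⟨s.filter fun k => heightDiff v φ h i (v k) = 0, ?_, ?_⟩
  · rw [mem_faces]
    refine ⟨⟨Finset.filter_subset _ _, heightDiff v φ h i, fun k hk => ⟨hl k hk, by simp [hk]⟩⟩, ?_⟩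
    refine le_antisymm (rank_le_one_of_forall (x := v i) fun k hk => ?_)
      (rank_pos (i := i) ?_ h0)
    · rw [Finset.mem_filter] at hk
      exact hg.mem_span hφ hi h0 hk.1 hk.2
    · simp [hi, heightDiff_apply, mul_comm]
  · simp [hi, heightDiff_apply, mul_comm]

/-- Exactly two rank one faces are lowest or highest. -/
theorem card_filter_not_crosses {v : ι → V} {s : Finset ι} {φ h : Dual ℝ V}
    (hφ : IsPositive v s φ) (hg : IsGeneric v s φ h) (hr : 2 ≤ rank v s) :
    ((faces v s 1).filter fun A => ¬ Crosses v φ h A s).card = 2 := by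
  have hs := exists_ne_zero_of_rank_pos (v := v) (F := s) (by omega)
  obtain ⟨i, hi, hi0, hil⟩ := exists_lowest h hφ hs
  obtain ⟨j, hj, hj0, hjl⟩ := exists_lowest (-h) hφ hs
  obtain ⟨A, hA, hiA⟩ := exists_face_of_lowest hφ hg hi hi0 hil
  obtain ⟨B, hB, hjB⟩ := exists_face_of_lowest hφ hg.neg hj hj0 hjl
  simp only [heightDiff_neg, Left.nonneg_neg_iff] at hjl
  have hA' := mem_faces.1 hA
  have hB' := mem_faces.1 hB
  rw [Finset.card_eq_two]
  refine ⟨A, B, ?_, ?_⟩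
  -- If the lowest and the highest face coincide, the height is constant, and genericity makes all
  -- vectors parallel, against rank at least two.
  · rintro rfl
    have hle : rank v s ≤ 1 := by
      refine rank_le_one_of_forall (x := v i) fun k hk => hg.mem_span hφ hi hi0 hk ?_
      refine le_antisymm ?_ (hil k hk)
      by_contra! hpos
      have hj' : ¬ ∃ l ∈ s, 0 < heightDiff v φ h j (v l) := by
        rintro ⟨l, hl, hl'⟩
        exact absurd (hjl l hl) (not_le.2 hl')
      obtain ⟨c, hc⟩ := mem_span_singleton.1 (mem_span_singleton_of_rank_one hA'.2 hjB hj0 hiA)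
      have hD : heightDiff v φ h i (v k) = c * heightDiff v φ h j (v k) := by
        simp only [heightDiff_apply, ← hc, map_smul, smul_eq_mul]
        ring
      have hp := hφ j hj hj0
      have hp' := hφ.apply_nonneg hi
      have hc0 : 0 ≤ c := by
        rw [← hc, map_smul, smul_eq_mul] at hp'
        exact nonneg_of_mul_nonneg_left hp' hp
      have := hjl k hk
      nlinarith
    omega
  · ext C
    simp only [Finset.mem_filter, Finset.mem_insert, Finset.mem_singleton]
    constructor
    · rintro ⟨hC, hcr⟩
      have hC' := mem_faces.1 hC
      obtain ⟨k, hk, hk0⟩ := exists_ne_zero_of_rank_pos hC'.2.ge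
      have hks := hC'.1.1 hk
      rw [crosses_iff hφ hC'.1.1 hC'.2 hk hk0, not_and_or] at hcr
      rcases hcr with hcr | hcr
      · left
        push Not at hcr
        have h1 := hcr i hi
        have h2 := hil k hks
        rw [heightDiff_swap] at h1
        have h3 : heightDiff v φ h i (v k) = 0 := by linarith
        refine eq_of_rank_one hC hA hk hk0 (hA'.1.mem_of_mem_span hks ?_)
        exact span_mono (by simpa using ⟨i, hiA, rfl⟩) (hg.mem_span hφ hi hi0 hks h3)
      · right
        push Not at hcr
        have h1 := hcr j hj
        have h2 := hjl k hks
        rw [heightDiff_swap] at h1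
        have h3 : heightDiff v φ h j (v k) = 0 := by linarith
        refine eq_of_rank_one hC hB hk hk0 (hB'.1.mem_of_mem_span hks ?_)
        exact span_mono (by simpa using ⟨j, hjB, rfl⟩) (hg.mem_span hφ hj hj0 hks h3)
    · rintro (rfl | rfl)
      · refine ⟨hA, ?_⟩
        rw [crosses_iff hφ hA'.1.1 hA'.2 hiA hi0]
        rintro ⟨⟨k, hk, hk'⟩, -⟩
        exact absurd (hil k hk) (not_le.2 hk')
      · refine ⟨hB, ?_⟩
        rw [crosses_iff hφ hB'.1.1 hB'.2 hjB hj0]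
        rintro ⟨-, k, hk, hk'⟩
        exact absurd (hjl k hk) (not_le.2 hk')

/-- A functional vanishing on two independent vectors of a plane vanishes on the plane. -/
theorem eq_zero_of_rank_two {v : ι → V} {s : Finset ι} (hr : rank v s = 2) {x y : V}
    (hx : x ∈ span ℝ (v '' (s : Set ι))) (hy : y ∈ span ℝ (v '' (s : Set ι)))
    (hxy : LinearIndependent ℝ ![x, y]) {D : Dual ℝ V} (h1 : D x = 0) (h2 : D y = 0) {k : ι}
    (hk : k ∈ s) : D (v k) = 0 := by
  have hle : span ℝ {x, y} ≤ span ℝ (v '' (s : Set ι)) := by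
    rw [span_le]
    rintro _ (rfl | rfl) <;> assumption
  have e : span ℝ {x, y} = span ℝ (v '' (s : Set ι)) := by
    refine Submodule.eq_of_le_of_finrank_eq hle ?_
    have := finrank_span_eq_card hxy
    rw [show Set.range ![x, y] = {x, y} by ext z; simp [or_comm]] at this
    rw [this]
    exact hr.symm
  have hm := VectorConfig.mem_span (v := v) hk
  rw [← e] at hm
  have : span ℝ {x, y} ≤ LinearMap.ker D := by
    rw [span_le]
    rintro _ (rfl | rfl) <;> assumption
  exact this hm

theorem linearIndependent_pair_of_dual {x y : V} (ψ : Dual ℝ V) (hx : x ≠ 0) (h1 : ψ x = 0)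
    (h2 : ψ y ≠ 0) : LinearIndependent ℝ ![x, y] := by
  rw [LinearIndependent.pair_iff]
  intro a b e
  have hb : b = 0 := by
    have := congrArg ψ e
    simpa [h1, h2] using this
  subst hb
  simpa [hx] using e

/-- A face with vectors of `s` strictly above and below it cannot occur in a plane: a positive
combination of those two vectors lies at the same height as the face but off its line, so the height
difference would vanish on the whole plane. Hence each rank one face is lowest or highest. -/
theorem card_faces_one_of_rank_two {v : ι → V} {s : Finset ι} (hp : IsPointed v s)
    (hr : rank v s = 2) : (faces v s 1).card = 2 := by
  obtain ⟨φ, hφ⟩ := hp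
  obtain ⟨h, hg⟩ := exists_isGeneric v s φ
  rw [← card_filter_not_crosses hφ hg hr.ge]
  congr 1
  symm
  rw [Finset.filter_eq_self]
  intro A hA hcr
  have hA' := mem_faces.1 hA
  obtain ⟨i, hi, hi0⟩ := exists_ne_zero_of_rank_pos hA'.2.ge
  obtain ⟨⟨k, hk, hk'⟩, l, hl, hl'⟩ := (crosses_iff hφ hA'.1.1 hA'.2 hi hi0).1 hcr
  obtain ⟨-, ψ, hψ⟩ := hA'.1
  have hDi : ∀ j ∈ A, heightDiff v φ h i (v j) = 0 :=
    fun j hj => heightDiff_eq_zero_of_mem φ h hA'.2 hi hi0 hj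
  set D := heightDiff v φ h i
  have hkA : k ∉ A := fun hh => by rw [hDi k hh] at hk'; exact lt_irrefl _ hk'
  have hlA : l ∉ A := fun hh => by rw [hDi l hh] at hl'; exact lt_irrefl _ hl'
  have p1 := hψ.pos_of_notMem hk hkA
  have p2 := hψ.pos_of_notMem hl hlA
  have hu : ψ (D (v l) • v k - D (v k) • v l) ≠ 0 := by
    simp only [map_sub, map_smul, smul_eq_mul]
    nlinarith
  have := eq_zero_of_rank_two hr (mem_span (hA'.1.1 hi))
    (sub_mem (smul_mem _ (D (v l)) (mem_span hk)) (smul_mem _ (D (v k)) (mem_span hl)))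
    (linearIndependent_pair_of_dual ψ hi0 (hψ.zero_of_mem hA'.1.1 hi) hu) (hDi i hi)
    (by simp only [map_sub, map_smul, smul_eq_mul]; ring) hk
  exact hk'.ne this

end VectorConfig

/-! ### Incidences between faces of consecutive ranks -/

namespace VectorConfig

open Module Submodule
open scoped Classical

variable {ι V : Type*} [AddCommGroup V] [Module ℝ V]

theorem card_faces_one_subset {v : ι → V} {s F : Finset ι} (hp : IsPointed v s)
    (hF : F ∈ faces v s 2) : ((faces v s 1).filter (· ⊆ F)).card = 2 := by
  rw [mem_faces] at hF
  rw [← faces_of_isFace hF.1]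
  exact card_faces_one_of_rank_two (hp.mono hF.1.1) hF.2

/-- The diamond property at the top: contracting `A` leaves a planar cone, which has two rays. -/
theorem card_faces_superset {v : ι → V} {s A : Finset ι} {r : ℕ} (hr : rank v s = r + 2)
    (hA : A ∈ faces v s r) : ((faces v s (r + 1)).filter (A ⊆ ·)).card = 2 := by
  rw [mem_faces] at hA
  have h := faces_contract hA.1 1
  rw [hA.2, add_comm 1 r] at h
  rw [← h]
  have := rank_contract v hA.1.1
  exact card_faces_one_of_rank_two (isPointed_contract hA.1) (by have := hA.2; omega)

theorem card_faces_one_eq_two {v : ι → V} {s : Finset ι} (hp : IsPointed v s)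
    (hr : rank v s = 3) : (faces v s 1).card = (faces v s 2).card := by
  have h := Finset.sum_card_bipartiteAbove_eq_sum_card_bipartiteBelow (s := faces v s 1)
    (t := faces v s 2) (· ⊆ ·)
  have h1 : ∀ A ∈ faces v s 1, (Finset.bipartiteAbove (· ⊆ ·) (faces v s 2) A).card = 2 :=
    fun A hA => card_faces_superset hr hA
  have h2 : ∀ F ∈ faces v s 2, (Finset.bipartiteBelow (· ⊆ ·) (faces v s 1) F).card = 2 :=
    fun F hF => card_faces_one_subset hp hF
  rw [Finset.sum_congr rfl h1, Finset.sum_congr rfl h2] at h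
  simpa using h

theorem faces_one_nonempty {v : ι → V} {s : Finset ι} (hp : IsPointed v s) (hr : 1 ≤ rank v s) :
    (faces v s 1).Nonempty := by
  obtain ⟨φ, hφ⟩ := hp
  obtain ⟨h, hg⟩ := exists_isGeneric v s φ
  obtain ⟨i, hi, h0, hl⟩ := exists_lowest h hφ (exists_ne_zero_of_rank_pos hr)
  obtain ⟨A, hA, -⟩ := exists_face_of_lowest hφ hg hi h0 hl
  exact ⟨A, hA⟩

theorem two_le_rank_of_ne {v : ι → V} {s A B F : Finset ι} (hA : A ∈ faces v s 1)
    (hB : B ∈ faces v s 1) (hne : A ≠ B) (hF : F ⊆ s) (hAF : A ⊆ F) (hBF : B ⊆ F) :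
    2 ≤ rank v F := by
  rw [mem_faces] at hA hB
  by_contra! hlt
  have e1 := hA.1.eq_of_subset_of_rank_le hF hAF (by have := hA.2; omega)
  have e2 := hB.1.eq_of_subset_of_rank_le hF hBF (by have := hB.2; omega)
  exact hne (e1.trans e2.symm)

theorem eq_of_two_le_rank_inter {v : ι → V} {s F G : Finset ι} {r : ℕ} (hF : F ∈ faces v s r)
    (hG : G ∈ faces v s r) (h : r ≤ rank v (F ∩ G)) : F = G := by
  rw [mem_faces] at hF hG
  have hI := hF.1.inter hG.1
  have e1 := hI.eq_of_subset_of_rank_le hF.1.1 Finset.inter_subset_left (by have := hF.2; omega)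
  have e2 := hI.eq_of_subset_of_rank_le hG.1.1 Finset.inter_subset_right (by have := hG.2; omega)
  exact e1.symm.trans e2

/-- An edge is determined by its two endpoints: two edges sharing both meet in a face of rank two,
hence agree. -/
theorem card_faces_two_le_choose {v : ι → V} {s : Finset ι} (hp : IsPointed v s) :
    (faces v s 2).card ≤ (faces v s 1).card.choose 2 := by
  rw [← Finset.card_powersetCard]
  refine Finset.card_le_card_of_injOn (fun F => (faces v s 1).filter (· ⊆ F)) ?_ ?_
  · intro F hF
    simp only [Finset.mem_coe, Finset.mem_powersetCard] at hF ⊢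
    exact ⟨Finset.filter_subset _ _, card_faces_one_subset hp hF⟩
  · intro F hF G hG e
    simp only at e
    have hc := card_faces_one_subset hp hF
    obtain ⟨A, B, hAB, hS⟩ := Finset.card_eq_two.1 hc
    have hA : A ∈ (faces v s 1).filter (· ⊆ F) := by simp [hS]
    have hB : B ∈ (faces v s 1).filter (· ⊆ F) := by simp [hS]
    have hA' := hA
    have hB' := hB
    rw [e] at hA' hB'
    rw [Finset.mem_filter] at hA hB hA' hB'
    refine eq_of_two_le_rank_inter hF hG (two_le_rank_of_ne hA.1 hB.1 hAB ?_ ?_ ?_)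
    · exact Finset.inter_subset_left.trans (mem_faces.1 hF).1.1
    · exact Finset.subset_inter hA.2 hA'.2
    · exact Finset.subset_inter hB.2 hB'.2

/-- A polygon with n vertices has n edges, and n ≤ C(n, 2) fails for n = 1, 2. -/
theorem three_le_card_faces_one {v : ι → V} {s : Finset ι} (hp : IsPointed v s)
    (hr : rank v s = 3) : 3 ≤ (faces v s 1).card := by
  have h1 := card_faces_two_le_choose hp
  rw [← card_faces_one_eq_two hp hr] at h1
  have h2 := (faces_one_nonempty hp (by omega)).card_pos
  by_contra! hlt
  interval_cases hc : (faces v s 1).card <;> simp at h1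

/-! ### Hyperplane sections of planar cones -/

/-- The configuration of intersections of the hyperplane `g = 0` with segments crossing it. -/
def sectionVec (v : ι → V) (g : Dual ℝ V) (p : ι × ι) : V :=
  g (v p.1) • v p.2 - g (v p.2) • v p.1

noncomputable def sectionIdx (v : ι → V) (g : Dual ℝ V) (s : Finset ι) : Finset (ι × ι) :=
  (s ×ˢ s).filter fun p => 0 < g (v p.1) ∧ g (v p.2) < 0

theorem mem_sectionIdx {v : ι → V} {g : Dual ℝ V} {s : Finset ι} {p : ι × ι} :
    p ∈ sectionIdx v g s ↔ p.1 ∈ s ∧ p.2 ∈ s ∧ 0 < g (v p.1) ∧ g (v p.2) < 0 := by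
  simp [sectionIdx, and_assoc]

/-- In a pointed cone, parallel nonzero vectors are positive multiples of each other, so `g` gives
them the same sign. -/
theorem two_le_rank_of_signs {v : ι → V} {s F : Finset ι} (hp : IsPointed v s) (hF : F ⊆ s)
    {g : Dual ℝ V} {k l : ι} (hk : k ∈ F) (hl : l ∈ F) (hgk : g (v k) < 0) (hgl : 0 < g (v l)) :
    2 ≤ rank v F := by
  obtain ⟨φ, hφ⟩ := hp
  have hl0 : v l ≠ 0 := fun e => by simp [e] at hgl
  have hk0 : v k ≠ 0 := fun e => by simp [e] at hgk
  by_contra! hlt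
  have h1 : rank v F = 1 := by have := rank_pos hl hl0; omega
  obtain ⟨c, hc⟩ := mem_span_singleton.1 (mem_span_singleton_of_rank_one h1 hl hl0 hk)
  have p1 := hφ k (hF hk) hk0
  have p2 := hφ l (hF hl) hl0
  rw [← hc, map_smul, smul_eq_mul] at p1 hgk
  nlinarith [pos_of_mul_pos_left p1 p2.le]

theorem sectionVec_ne_zero {v : ι → V} {s : Finset ι} (hp : IsPointed v s) {g : Dual ℝ V}
    {p : ι × ι} (hps : p ∈ sectionIdx v g s) : sectionVec v g p ≠ 0 := by
  obtain ⟨φ, hφ⟩ := hp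
  rw [mem_sectionIdx] at hps
  obtain ⟨h1, h2, h3, h4⟩ := hps
  have p1 := hφ _ h1 (fun e => by simp [e] at h3)
  have p2 := hφ _ h2 (fun e => by simp [e] at h4)
  intro e
  have := congrArg φ e
  simp only [sectionVec, map_sub, map_smul, smul_eq_mul, map_zero] at this
  nlinarith

theorem sectionVec_mem_span {v : ι → V} {g : Dual ℝ V} {F : Finset ι} {p : ι × ι}
    (h1 : p.1 ∈ F) (h2 : p.2 ∈ F) : sectionVec v g p ∈ span ℝ (v '' (F : Set ι)) :=
  sub_mem (smul_mem _ _ (mem_span h2)) (smul_mem _ _ (mem_span h1))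

theorem apply_sectionVec (v : ι → V) (g : Dual ℝ V) (p : ι × ι) : g (sectionVec v g p) = 0 := by
  simp only [sectionVec, map_sub, map_smul, smul_eq_mul]
  ring

/-- Sections of a family on which `g` does not vanish have smaller rank. -/
theorem rank_section_lt {v : ι → V} {F : Finset ι} {G : Finset (ι × ι)} {g : Dual ℝ V}
    (hG : ∀ p ∈ G, p.1 ∈ F ∧ p.2 ∈ F) {l : ι} (hl : l ∈ F) (hgl : g (v l) ≠ 0) :
    rank (sectionVec v g) G < rank v F := by
  refine Submodule.finrank_lt_finrank_of_lt (lt_of_le_of_ne ?_ ?_)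
  · rw [span_le]
    rintro _ ⟨p, hp, rfl⟩
    exact sectionVec_mem_span (hG p hp).1 (hG p hp).2
  · intro e
    have h1 := mem_span (v := v) hl
    rw [← e] at h1
    exact hgl (span_le_ker (fun p _ => apply_sectionVec v g p) h1)

/-- If all crossing points were parallel to the one between `k` and `l`, each `v i` could be
recovered from a crossing point and `v k` or `v l`, so the whole family would lie in a plane. -/
theorem two_le_rank_section {v : ι → V} {s : Finset ι} (hp : IsPointed v s) (hr : 3 ≤ rank v s)
    {g : Dual ℝ V} (hg : ∀ i ∈ s, g (v i) = 0 → v i = 0) {k l : ι} (hk : k ∈ s) (hl : l ∈ s)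
    (hgk : g (v k) < 0) (hgl : 0 < g (v l)) :
    2 ≤ rank (sectionVec v g) (sectionIdx v g s) := by
  have h0 : (l, k) ∈ sectionIdx v g s := by simp [mem_sectionIdx, *]
  have hne := sectionVec_ne_zero hp h0
  by_contra! hlt
  have h1 : rank (sectionVec v g) (sectionIdx v g s) = 1 := by
    have := rank_pos h0 hne; omega
  have key : ∀ p ∈ sectionIdx v g s, sectionVec v g p ∈ span ℝ {v k, v l} := by
    intro p hps
    have hm := mem_span_singleton_of_rank_one h1 h0 hne hps
    refine (span_singleton_le_iff_mem _ _).2 ?_ hm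
    exact sub_mem (smul_mem _ _ (subset_span (by simp))) (smul_mem _ _ (subset_span (by simp)))
  have hle : span ℝ (v '' (s : Set ι)) ≤ span ℝ (({v k, v l} : Finset V) : Set V) := by
    rw [span_le]
    rintro _ ⟨i, hi, rfl⟩
    simp only [Finset.coe_insert, Finset.coe_singleton, SetLike.mem_coe]
    have hi : i ∈ s := hi
    rcases lt_trichotomy (g (v i)) 0 with h | h | h
    · have := key (l, i) (by simp [mem_sectionIdx, *])
      have h2 := add_mem this (smul_mem _ (g (v i)) (subset_span (s := {v k, v l}) (by simp :
        v l ∈ ({v k, v l} : Set V))))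
      simp only [sectionVec, sub_add_cancel] at h2
      exact (smul_mem_iff _ hgl.ne').1 h2
    · rw [hg i hi h]
      exact zero_mem _
    · have := key (i, k) (by simp [mem_sectionIdx, *])
      have h2 := sub_mem (smul_mem _ (g (v i)) (subset_span (s := {v k, v l}) (by simp :
        v k ∈ ({v k, v l} : Set V)))) this
      simp only [sectionVec, sub_sub_cancel] at h2
      exact (smul_mem_iff _ hgk.ne).1 h2
  have h3 := (Submodule.finrank_mono hle).trans (finrank_span_finset_le_card _)
  have h4 : ({v k, v l} : Finset V).card ≤ 2 := Finset.card_le_two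
  unfold rank at hr
  omega

theorem isPointed_section {v : ι → V} {s : Finset ι} (hp : IsPointed v s) (g : Dual ℝ V) :
    IsPointed (sectionVec v g) (sectionIdx v g s) := by
  obtain ⟨φ, hφ⟩ := hp
  refine ⟨φ, fun p hps _ => ?_⟩
  rw [mem_sectionIdx] at hps
  obtain ⟨h1, h2, h3, h4⟩ := hps
  have p1 := hφ _ h1 (fun e => by simp [e] at h3)
  have p2 := hφ _ h2 (fun e => by simp [e] at h4)
  simp only [sectionVec, map_sub, map_smul, smul_eq_mul]
  nlinarith

/-- A rank one face of the section extends to a face meeting both sides of the hyperplane. -/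
theorem exists_face_of_section {v : ι → V} {s : Finset ι} {g : Dual ℝ V}
    (hg : ∀ i ∈ s, g (v i) = 0 → v i = 0) {G : Finset (ι × ι)}
    (hG : IsFace (sectionVec v g) (sectionIdx v g s) G) {p : ι × ι} (hp : p ∈ G) :
    ∃ F, IsFace v s F ∧ ∀ q ∈ sectionIdx v g s, q ∈ G ↔ q.1 ∈ F ∧ q.2 ∈ F := by
  obtain ⟨hGs, ψ, hψ⟩ := hG
  obtain ⟨p1, p2, p3, p4⟩ := mem_sectionIdx.1 (hGs hp)
  have hp0 := hψ.zero_of_mem hGs hp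
  simp only [sectionVec, map_sub, map_smul, smul_eq_mul] at hp0
  -- Adding a multiple of `g` does not change `ψ` on the section. This multiple makes the functional
  -- vanish at `p.1`, hence also at `p.2`; pairing any other index with one of these two gives its
  -- sign.
  set c := - ψ (v p.1) / g (v p.1) with hc
  have hc1 : ψ (v p.1) = - c * g (v p.1) := by
    rw [hc]; field_simp
  have hc2 : ψ (v p.2) = - c * g (v p.2) := by
    rw [hc1] at hp0
    have : g (v p.1) * (ψ (v p.2) + c * g (v p.2)) = 0 := by linarith
    rcases mul_eq_zero.1 this with h | h <;> linarith
  have hval : ∀ i, (ψ + c • g) (v i) = ψ (v i) + c * g (v i) := fun i => by simp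
  have hsec : ∀ a b, ψ (sectionVec v g (a, b)) =
      g (v a) * (ψ + c • g) (v b) - g (v b) * (ψ + c • g) (v a) := fun a b => by
    simp only [hval, sectionVec, map_sub, map_smul, smul_eq_mul]; ring
  have hz1 : (ψ + c • g) (v p.1) = 0 := by rw [hval, hc1]; ring
  have hz2 : (ψ + c • g) (v p.2) = 0 := by rw [hval, hc2]; ring
  have hnn : ∀ i ∈ s, 0 ≤ (ψ + c • g) (v i) := by
    intro i hi
    rcases lt_trichotomy (g (v i)) 0 with h | h | h
    · have := (hψ (p.1, i) (by simp [mem_sectionIdx, *])).1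
      rw [hsec, hz1, mul_zero, sub_zero] at this
      exact nonneg_of_mul_nonneg_right this p3
    · simp [hg i hi h]
    · have := (hψ (i, p.2) (by simp [mem_sectionIdx, *])).1
      rw [hsec, hz2, mul_zero, zero_sub] at this
      by_contra! hn
      nlinarith
  refine ⟨s.filter fun i => (ψ + c • g) (v i) = 0,
    ⟨Finset.filter_subset _ _, ψ + c • g, fun i hi => ⟨hnn i hi, ?_⟩⟩, ?_⟩
  · rw [Finset.mem_filter]
    exact ⟨fun h => ⟨hi, h⟩, fun h => h.2⟩
  · rintro ⟨a, b⟩ hq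
    obtain ⟨q1, q2, q3, q4⟩ := mem_sectionIdx.1 hq
    have na := hnn a q1
    have nb := hnn b q2
    rw [← (hψ _ hq).2, hsec, Finset.mem_filter, Finset.mem_filter]
    simp only at q1 q2 q3 q4 ⊢
    constructor
    · intro e
      have e1 := mul_nonneg q3.le nb
      have e2 : 0 ≤ -g (v b) * (ψ + c • g) (v a) := mul_nonneg (by linarith) na
      have e3 : g (v a) * (ψ + c • g) (v b) = 0 := by linarith
      have e4 : g (v b) * (ψ + c • g) (v a) = 0 := by linarith
      exact ⟨⟨q1, (mul_eq_zero.1 e4).resolve_left q4.ne⟩,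
        q2, (mul_eq_zero.1 e3).resolve_left q3.ne'⟩
    · rintro ⟨⟨-, e1⟩, -, e2⟩
      rw [e1, e2]; ring

/-- In rank three, a functional taking both signs takes both signs on exactly two faces of
rank two. -/
theorem card_crossing_faces {v : ι → V} {s : Finset ι} (hp : IsPointed v s) (hr : rank v s = 3)
    {g : Dual ℝ V} (hg : ∀ i ∈ s, g (v i) = 0 → v i = 0) (hneg : ∃ k ∈ s, g (v k) < 0)
    (hpos : ∃ l ∈ s, 0 < g (v l)) :
    ((faces v s 2).filter fun F => (∃ k ∈ F, g (v k) < 0) ∧ ∃ l ∈ F, 0 < g (v l)).card = 2 := by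
  obtain ⟨k, hk, hgk⟩ := hneg
  obtain ⟨l, hl, hgl⟩ := hpos
  have h2 : rank (sectionVec v g) (sectionIdx v g s) = 2 := by
    have h3 := two_le_rank_section hp hr.ge hg hk hl hgk hgl
    have h4 : rank (sectionVec v g) (sectionIdx v g s) < rank v s :=
      rank_section_lt (fun p hp => ⟨(mem_sectionIdx.1 hp).1, (mem_sectionIdx.1 hp).2.1⟩) hl hgl.ne'
    omega
  -- Crossed edges of the polygon correspond to the two ends of the segment cut out by `g = 0`.
  refine Eq.trans (Finset.card_bij
    (fun F _ => (sectionIdx v g s).filter fun p => p.1 ∈ F ∧ p.2 ∈ F) ?_ ?_ ?_)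
    (card_faces_one_of_rank_two (isPointed_section hp g) h2)
  · intro F hF
    rw [Finset.mem_filter, mem_faces] at hF
    obtain ⟨⟨⟨hFs, φ, hφ⟩, hF2⟩, ⟨a, ha, hga⟩, b, hb, hgb⟩ := hF
    rw [mem_faces]
    refine ⟨⟨Finset.filter_subset _ _, φ, fun p hps => ?_⟩, ?_⟩
    · obtain ⟨q1, q2, q3, q4⟩ := mem_sectionIdx.1 hps
      obtain ⟨n1, z1⟩ := hφ _ q1
      obtain ⟨n2, z2⟩ := hφ _ q2
      have e1 := mul_nonneg q3.le n2
      have e2 : 0 ≤ -g (v p.2) * φ (v p.1) := mul_nonneg (by linarith) n1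
      simp only [sectionVec, map_sub, map_smul, smul_eq_mul, Finset.mem_filter, hps, true_and]
      rw [← z1, ← z2]
      refine ⟨by linarith, fun e => ?_, fun e => by rw [e.1, e.2]; ring⟩
      have e3 : g (v p.1) * φ (v p.2) = 0 := by linarith
      have e4 : g (v p.2) * φ (v p.1) = 0 := by linarith
      exact ⟨(mul_eq_zero.1 e4).resolve_left q4.ne, (mul_eq_zero.1 e3).resolve_left q3.ne'⟩
    · refine le_antisymm ?_ (rank_pos (i := (b, a)) ?_ (sectionVec_ne_zero hp (s := s) ?_))
      · have := rank_section_lt (v := v) (F := F) (g := g)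
          (G := (sectionIdx v g s).filter fun p => p.1 ∈ F ∧ p.2 ∈ F)
          (fun p hp => (Finset.mem_filter.1 hp).2) hb hgb.ne'
        omega
      · simp [mem_sectionIdx, hFs ha, hFs hb, *]
      · simp [mem_sectionIdx, hFs ha, hFs hb, *]
  · intro F hF F' hF' e
    rw [Finset.mem_filter] at hF hF'
    obtain ⟨hF, ⟨a, ha, hga⟩, b, hb, hgb⟩ := hF
    have hFs := (mem_faces.1 hF).1.1
    have hm : (b, a) ∈ (sectionIdx v g s).filter fun p => p.1 ∈ F ∧ p.2 ∈ F := by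
      simp [mem_sectionIdx, hFs ha, hFs hb, ha, hb, hga, hgb]
    rw [e, Finset.mem_filter] at hm
    refine eq_of_two_le_rank_inter hF hF'.1 (two_le_rank_of_signs hp
      (Finset.inter_subset_left.trans hFs) (k := a) (l := b) ?_ ?_ hga hgb)
    · exact Finset.mem_inter.2 ⟨ha, hm.2.2⟩
    · exact Finset.mem_inter.2 ⟨hb, hm.2.1⟩
  · intro G hG
    rw [mem_faces] at hG
    obtain ⟨p, hpG, -⟩ := exists_ne_zero_of_rank_pos hG.2.ge
    obtain ⟨F, hF, hFG⟩ := exists_face_of_section hg hG.1 hpG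
    have hpG' := (hFG p (hG.1.1 hpG)).1 hpG
    obtain ⟨q1, q2, q3, q4⟩ := mem_sectionIdx.1 (hG.1.1 hpG)
    have hrF := two_le_rank_of_signs hp hF.1 hpG'.2 hpG'.1 q4 q3
    have e : (sectionIdx v g s).filter (fun p => p.1 ∈ F ∧ p.2 ∈ F) = G := by
      ext q
      rw [Finset.mem_filter]
      exact ⟨fun h => (hFG q h.1).2 h.2, fun h => ⟨hG.1.1 h, (hFG q (hG.1.1 h)).1 h⟩⟩
    refine ⟨F, ?_, e⟩
    rw [Finset.mem_filter, mem_faces]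
    refine ⟨⟨hF, ?_⟩, ⟨_, hpG'.2, q4⟩, _, hpG'.1, q3⟩
    have : rank v F ≤ 2 := by
      by_contra! hlt
      -- A face of full rank would make `G` the whole section, which has rank two and not one.
      have hFs : F = s := hF.eq_of_subset_of_rank_le subset_rfl hF.1 (by omega)
      have : G = sectionIdx v g s := by
        rw [← e, Finset.filter_eq_self]
        intro q hq
        rw [hFs]
        exact ⟨(mem_sectionIdx.1 hq).1, (mem_sectionIdx.1 hq).2.1⟩
      rw [this] at hG
      omega
    omega

end VectorConfig

/-! ### Euler's relation in rank four and face number inequalities in rank five -/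

namespace VectorConfig

open Module Submodule
open scoped Classical

variable {ι V : Type*} [AddCommGroup V] [Module ℝ V]

theorem Crosses.mono {v : ι → V} {φ h : Dual ℝ V} {A F G : Finset ι} (hc : Crosses v φ h A F)
    (hFG : F ⊆ G) : Crosses v φ h A G := by
  obtain ⟨i, hi, ⟨k, hk, hk'⟩, l, hl, hl'⟩ := hc
  exact ⟨i, hi, ⟨k, hFG hk, hk'⟩, l, hFG hl, hl'⟩

/-- In the vertex figure at `A`, a polygon whose edges are the 2-faces through `A`, the height
difference from `A` becomes a functional that is nonzero at all vertices by genericity. If it takes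
both signs, it cuts exactly two edges. -/
theorem card_crossing_faces_superset {v : ι → V} {s : Finset ι} {φ h : Dual ℝ V}
    (hφ : IsPositive v s φ) (hg : IsGeneric v s φ h) (hr : rank v s = 4) {A : Finset ι}
    (hA : A ∈ faces v s 1) :
    ((faces v s 3).filter fun F => A ⊆ F ∧ Crosses v φ h A F).card =
      if Crosses v φ h A s then 2 else 0 := by
  have hA' := mem_faces.1 hA
  split_ifs with hc
  · obtain ⟨i, hi, hi0⟩ := exists_ne_zero_of_rank_pos hA'.2.ge
    have his := hA'.1.1 hi
    have hD : ∀ j ∈ A, heightDiff v φ h i (v j) = 0 :=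
      fun j hj => heightDiff_eq_zero_of_mem φ h hA'.2 hi hi0 hj
    let g := liftQ (span ℝ (v '' (A : Set ι))) (heightDiff v φ h i) (span_le_ker hD)
    have hgv : ∀ k, g (contract v A k) = heightDiff v φ h i (v k) := fun k => by
      simp [g, contract]
    have hr3 : rank (contract v A) s = 3 := by
      have := rank_contract v hA'.1.1
      have := hA'.2
      omega
    have hcr := (crosses_iff hφ hA'.1.1 hA'.2 hi hi0).1 hc
    have key := card_crossing_faces (isPointed_contract hA'.1) hr3 (g := g) ?_ ?_ ?_
    · rw [← key, faces_contract hA'.1, hA'.2, Finset.filter_filter]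
      congr 1
      ext F
      simp only [Finset.mem_filter, hgv, crosses_iff hφ hA'.1.1 hA'.2 hi hi0]
    · intro k hk e
      rw [hgv] at e
      have := hg.mem_span hφ his hi0 hk e
      simp only [contract, mkQ_apply, Quotient.mk_eq_zero]
      exact span_mono (by simpa using ⟨i, hi, rfl⟩) this
    · simpa only [hgv] using hcr.1
    · simpa only [hgv] using hcr.2
  · rw [Finset.card_eq_zero, Finset.filter_eq_empty_iff]
    rintro F hF ⟨-, hF'⟩
    exact hc (hF'.mono (mem_faces.1 hF).1.1)

/-- Euler's relation for three-dimensional polytopes. -/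
theorem euler_rank_four {v : ι → V} {s : Finset ι} (hp : IsPointed v s) (hr : rank v s = 4) :
    (faces v s 2).card + 2 = (faces v s 1).card + (faces v s 3).card ∧
      ∑ F ∈ faces v s 3, (faces v F 1).card = 2 * (faces v s 2).card := by
  have h2 : ∑ F ∈ faces v s 3, (faces v F 1).card = 2 * (faces v s 2).card := by
    have h := Finset.sum_card_bipartiteAbove_eq_sum_card_bipartiteBelow (s := faces v s 2)
      (t := faces v s 3) (· ⊆ ·)
    have h1 : ∀ A ∈ faces v s 2, (Finset.bipartiteAbove (· ⊆ ·) (faces v s 3) A).card = 2 :=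
      fun A hA => card_faces_superset hr hA
    have h2 : ∀ F ∈ faces v s 3, (Finset.bipartiteBelow (· ⊆ ·) (faces v s 2) F).card =
        (faces v F 1).card := by
      intro F hF
      rw [mem_faces] at hF
      rw [card_faces_one_eq_two (hp.mono hF.1.1) hF.2, faces_of_isFace hF.1]
      rfl
    rw [Finset.sum_congr rfl h1, Finset.sum_congr rfl h2] at h
    rw [← h]
    simp [mul_comm]
  refine ⟨?_, h2⟩
  obtain ⟨φ, hφ⟩ := id hp
  obtain ⟨h, hg⟩ := exists_isGeneric v s φ
  -- Count pairs of a vertex and a 2-face through it with points strictly above and below the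
  -- vertex. Each vertex except top and bottom contributes 2, and a 2-face with m vertices
  -- contributes m − 2. Thus 2(f₀ − 2) = 2f₁ − 2f₂.
  have hd := Finset.sum_card_bipartiteAbove_eq_sum_card_bipartiteBelow (s := faces v s 1)
    (t := faces v s 3) (fun A F => A ⊆ F ∧ Crosses v φ h A F)
  have h1 : ∀ A ∈ faces v s 1,
      (Finset.bipartiteAbove (fun A F => A ⊆ F ∧ Crosses v φ h A F) (faces v s 3) A).card =
        if Crosses v φ h A s then 2 else 0 := by
    intro A hA
    rw [← card_crossing_faces_superset hφ hg hr hA]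
    unfold Finset.bipartiteAbove
    congr
  rw [Finset.sum_congr rfl h1] at hd
  rw [← Finset.sum_filter, Finset.sum_const, smul_eq_mul] at hd
  have h3 := Finset.card_filter_add_card_filter_not (s := faces v s 1) (fun A => Crosses v φ h A s)
  rw [card_filter_not_crosses hφ hg (by omega)] at h3
  have h4 : ∀ F ∈ faces v s 3, (faces v F 1).card =
      (Finset.bipartiteBelow (fun A F => A ⊆ F ∧ Crosses v φ h A F) (faces v s 1) F).card + 2 := by
    intro F hF
    rw [mem_faces] at hF
    have h5 := Finset.card_filter_add_card_filter_not (s := faces v F 1)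
      (fun A => Crosses v φ h A F)
    rw [card_filter_not_crosses (hφ.mono hF.1.1) (hg.mono hF.1.1) (by have := hF.2; omega)] at h5
    rw [← h5, faces_of_isFace hF.1, Finset.filter_filter]
    rfl
  rw [Finset.sum_congr rfl h4, Finset.sum_add_distrib, ← hd, Finset.sum_const, smul_eq_mul] at h2
  omega

/-- Every 2-face has at least three edges and every edge lies in two 2-faces, so 3f₂ ≤ 2f₁;
substitute this in Euler's relation. -/
theorem card_faces_two_add_six_le {v : ι → V} {s : Finset ι} (hp : IsPointed v s)
    (hr : rank v s = 4) : (faces v s 2).card + 6 ≤ 3 * (faces v s 1).card := by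
  obtain ⟨h1, h2⟩ := euler_rank_four hp hr
  have h3 : (faces v s 3).card • 3 ≤ ∑ F ∈ faces v s 3, (faces v F 1).card := by
    refine Finset.card_nsmul_le_sum _ _ _ fun F hF => ?_
    rw [mem_faces] at hF
    exact three_le_card_faces_one (hp.mono hF.1.1) hF.2
  rw [smul_eq_mul] at h3
  omega

theorem card_faces_two_add_six_ge {v : ι → V} {s : Finset ι} (hp : IsPointed v s)
    (hr : rank v s = 4) (hs : ∀ F ∈ faces v s 3, (faces v F 1).card ≤ 3) :
    3 * (faces v s 1).card ≤ (faces v s 2).card + 6 := by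
  obtain ⟨h1, h2⟩ := euler_rank_four hp hr
  have h3 : ∑ F ∈ faces v s 3, (faces v F 1).card ≤ (faces v s 3).card • 3 :=
    Finset.sum_le_card_nsmul _ _ _ hs
  rw [smul_eq_mul] at h3
  omega

/-! ### Summation over vertex figures in rank five -/

theorem sum_card_faces_superset_two {v : ι → V} {s : Finset ι} (hp : IsPointed v s) :
    ∑ A ∈ faces v s 1, ((faces v s 2).filter (A ⊆ ·)).card = 2 * (faces v s 2).card := by
  have h := Finset.sum_card_bipartiteAbove_eq_sum_card_bipartiteBelow (s := faces v s 1)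
    (t := faces v s 2) (· ⊆ ·)
  have h2 : ∀ F ∈ faces v s 2, (Finset.bipartiteBelow (· ⊆ ·) (faces v s 1) F).card = 2 :=
    fun F hF => card_faces_one_subset hp hF
  rw [Finset.sum_congr rfl h2] at h
  rw [Finset.sum_const, smul_eq_mul, mul_comm] at h
  exact h

theorem sum_card_faces_superset_three {v : ι → V} {s : Finset ι} :
    ∑ A ∈ faces v s 1, ((faces v s 3).filter (A ⊆ ·)).card =
      ∑ F ∈ faces v s 3, (faces v F 1).card := by
  have h := Finset.sum_card_bipartiteAbove_eq_sum_card_bipartiteBelow (s := faces v s 1)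
    (t := faces v s 3) (· ⊆ ·)
  refine Eq.trans h (Finset.sum_congr rfl fun F hF => ?_)
  rw [faces_of_isFace (mem_faces.1 hF).1]
  rfl

theorem rank_contract_of_mem_faces {v : ι → V} {s A : Finset ι} {r k : ℕ} (hr : rank v s = r + k)
    (hA : A ∈ faces v s k) : rank (contract v A) s = r := by
  rw [mem_faces] at hA
  have := rank_contract v hA.1.1
  have := hA.2
  omega

/-- The number of ridges of a four-dimensional polytope is at most twice the difference of the
numbers of edges and of vertices. -/
theorem card_faces_three_add_le {v : ι → V} {s : Finset ι} (hp : IsPointed v s)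
    (hr : rank v s = 5) :
    (faces v s 3).card + 2 * (faces v s 1).card ≤ 2 * (faces v s 2).card := by
  -- The vertices and edges of the vertex figure at `A` are the edges and 2-faces through `A`.
  have h1 : ∀ A ∈ faces v s 1, ((faces v s 3).filter (A ⊆ ·)).card + 6 ≤
      3 * ((faces v s 2).filter (A ⊆ ·)).card := by
    intro A hA
    have hA' := mem_faces.1 hA
    have := card_faces_two_add_six_le (isPointed_contract hA'.1)
      (rank_contract_of_mem_faces hr hA)
    rwa [faces_contract hA'.1, faces_contract hA'.1, hA'.2] at this
  have h2 := Finset.sum_le_sum h1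
  rw [Finset.sum_add_distrib, ← Finset.mul_sum, sum_card_faces_superset_two hp,
    sum_card_faces_superset_three, Finset.sum_const, smul_eq_mul] at h2
  have h3 : (faces v s 3).card • 3 ≤ ∑ F ∈ faces v s 3, (faces v F 1).card := by
    refine Finset.card_nsmul_le_sum _ _ _ fun F hF => ?_
    rw [mem_faces] at hF
    exact three_le_card_faces_one (hp.mono hF.1.1) hF.2
  rw [smul_eq_mul] at h3
  omega

/-- The faces of rank smaller than `d` are independent sets. -/
def IsSimplicial (v : ι → V) (s : Finset ι) (d : ℕ) : Prop :=
  ∀ F, IsFace v s F → rank v F < d → F.card = rank v F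

/-- Simpliciality makes the 2-faces, and those of the vertex figures, triangles, so both estimates
behind `card_faces_three_add_le` are sharp. -/
theorem card_faces_three_add_ge {v : ι → V} {s : Finset ι} (hp : IsPointed v s)
    (hr : rank v s = 5) (hs : IsSimplicial v s 5) :
    2 * (faces v s 2).card ≤ (faces v s 3).card + 2 * (faces v s 1).card := by
  have hcard : ∀ {F r}, F ∈ faces v s r → r < 5 → F.card = r := by
    intro F r hF hr
    rw [mem_faces] at hF
    rw [hs F hF.1 (by have := hF.2; omega), hF.2]
  have h1 : ∀ A ∈ faces v s 1, 3 * ((faces v s 2).filter (A ⊆ ·)).card ≤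
      ((faces v s 3).filter (A ⊆ ·)).card + 6 := by
    intro A hA
    have hA' := mem_faces.1 hA
    have := card_faces_two_add_six_ge (isPointed_contract hA'.1)
      (rank_contract_of_mem_faces hr hA) ?_
    · rwa [faces_contract hA'.1, faces_contract hA'.1, hA'.2] at this
    · intro F hF
      have hF' := hF
      rw [faces_contract hA'.1, Finset.mem_filter, hA'.2] at hF
      rw [faces_of_isFace (mem_faces.1 hF').1, faces_contract hA'.1, hA'.2, Finset.filter_filter]
      have hF4 := hcard hF.1 (by norm_num)
      have hA1 := hcard hA (by norm_num)
      have h3 : (F \ A).card = 3 := by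
        rw [Finset.card_sdiff_of_subset hF.2]; omega
      have h4 : ((F \ A).image fun i => insert i A).card ≤ 3 :=
        Finset.card_image_le.trans h3.le
      refine (Finset.card_le_card fun G hG => ?_).trans h4
      rw [Finset.mem_filter] at hG
      obtain ⟨hG, hAG, hGF⟩ := hG
      have hG2 := hcard hG (by norm_num)
      have h5 : (G \ A).card = 1 := by
        rw [Finset.card_sdiff_of_subset hAG]; omega
      obtain ⟨i, hi⟩ := Finset.card_eq_one.1 h5
      have hiG : i ∈ G \ A := by simp [hi]
      rw [Finset.mem_sdiff] at hiG
      rw [Finset.mem_image]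
      refine ⟨i, by simp [hGF hiG.1, hiG.2], ?_⟩
      rw [← Finset.sdiff_union_of_subset hAG, hi, Finset.singleton_union]
  have h2 := Finset.sum_le_sum h1
  rw [Finset.sum_add_distrib, ← Finset.mul_sum, sum_card_faces_superset_two hp,
    sum_card_faces_superset_three, Finset.sum_const, smul_eq_mul] at h2
  have h3 : ∑ F ∈ faces v s 3, (faces v F 1).card ≤ (faces v s 3).card • 3 := by
    refine Finset.sum_le_card_nsmul _ _ _ fun F hF => ?_
    have hF3 := hcard hF (by norm_num)
    rw [faces_of_isFace (mem_faces.1 hF).1]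
    have h4 : (F.image fun i => ({i} : Finset ι)).card ≤ 3 := Finset.card_image_le.trans hF3.le
    refine (Finset.card_le_card fun G hG => ?_).trans h4
    rw [Finset.mem_filter] at hG
    obtain ⟨i, rfl⟩ := Finset.card_eq_one.1 (hcard hG.1 (by norm_num))
    simpa using hG.2
  rw [smul_eq_mul] at h3
  omega

/-! ### Configurations in general position -/

theorem rank_le_card (v : ι → V) (F : Finset ι) : rank v F ≤ F.card := by
  unfold rank
  rw [← Finset.coe_image]
  exact (finrank_span_finset_le_card _).trans Finset.card_image_le

theorem rank_union_le (v : ι → V) (F G : Finset ι) : rank v (F ∪ G) ≤ rank v F + rank v G := by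
  unfold rank
  rw [Finset.coe_union, Set.image_union, span_union]
  exact Submodule.finrank_add_le_finrank_add_finrank _ _

theorem rank_eq_finrank [FiniteDimensional ℝ V] {v : ι → V} {F : Finset ι}
    (h : ∀ φ : Dual ℝ V, (∀ i ∈ F, φ (v i) = 0) → φ = 0) : rank v F = finrank ℝ V := by
  have : span ℝ (v '' (F : Set ι)) = ⊤ := by
    by_contra hne
    obtain ⟨φ, hφ, hle⟩ := Submodule.exists_le_ker_of_lt_top _ (lt_top_iff_ne_top.2 hne)
    exact hφ (h φ fun i hi => hle (mem_span hi))
  unfold rank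
  rw [this, finrank_top]

/-- If nonzero functionals vanish on fewer than `d` members of a family in a `d`-dimensional
space, then every subfamily with at most `d` members is independent. -/
theorem rank_eq_card [FiniteDimensional ℝ V] {v : ι → V} {s : Finset ι}
    (h : ∀ F ⊆ s, F.card = finrank ℝ V → ∀ φ : Dual ℝ V, (∀ i ∈ F, φ (v i) = 0) → φ = 0)
    (hs : finrank ℝ V ≤ s.card) {F : Finset ι} (hF : F ⊆ s) (hc : F.card ≤ finrank ℝ V) :
    rank v F = F.card := by
  obtain ⟨G, hFG, hGs, hG⟩ := Finset.exists_subsuperset_card_eq hF hc hs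
  have h1 := rank_eq_finrank (h G hGs hG)
  have h2 := rank_union_le v F (G \ F)
  rw [Finset.union_sdiff_of_subset hFG] at h2
  have h3 := rank_le_card v (G \ F)
  have h4 := Finset.card_sdiff_add_card_eq_card hFG
  have h5 := rank_le_card v F
  omega

/-- Any d members span the space, so a face of smaller rank has fewer than d members, and these are
independent. -/
theorem isSimplicial_of_generalPosition [FiniteDimensional ℝ V] {v : ι → V} {s : Finset ι}
    (h : ∀ F ⊆ s, F.card = finrank ℝ V → ∀ φ : Dual ℝ V, (∀ i ∈ F, φ (v i) = 0) → φ = 0)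
    (hs : finrank ℝ V ≤ s.card) : IsSimplicial v s (finrank ℝ V) := by
  intro F hF hr
  refine (rank_eq_card h hs hF.1 ?_).symm
  by_contra! hlt
  obtain ⟨G, hGF, hG⟩ := Finset.exists_subset_card_eq hlt.le
  have h1 := rank_eq_finrank (h G (hGF.trans hF.1) hG)
  have := rank_mono (v := v) hGF
  omega

end VectorConfig

/-! ### Faces of polytopes as faces of vector configurations -/

namespace VectorConfig

open Module Submodule
open scoped Classical

variable {ι : Type*} {d : ℕ}

/-- The homogenization of a family of points. -/
def homog (pts : ι → Fin d → ℝ) (i : ι) : (Fin d → ℝ) × ℝ := (pts i, 1)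

theorem span_homog (pts : ι → Fin d → ℝ) {F : Finset ι} {i : ι} (hi : i ∈ F) :
    span ℝ (homog pts '' (F : Set ι)) =
      (vectorSpan ℝ (pts '' (F : Set ι))).map (LinearMap.inl ℝ (Fin d → ℝ) ℝ) ⊔
        span ℝ {homog pts i} := by
  refine le_antisymm (span_le.2 ?_) (sup_le ?_ ?_)
  · rintro _ ⟨k, hk, rfl⟩
    refine mem_sup.2 ⟨(pts k - pts i, 0), ?_, homog pts i, mem_span_singleton_self _, ?_⟩
    · exact ⟨pts k - pts i, vsub_mem_vectorSpan ℝ ⟨k, hk, rfl⟩ ⟨i, hi, rfl⟩, rfl⟩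
    · simp [homog]
  · rw [map_le_iff_le_comap, vectorSpan_def, span_le]
    rintro _ ⟨_, ⟨a, ha, rfl⟩, _, ⟨b, hb, rfl⟩, rfl⟩
    have := sub_mem (mem_span (v := homog pts) (F := F) ha) (mem_span (v := homog pts) (F := F) hb)
    simpa [homog] using this
  · rw [span_singleton_le_iff_mem]
    exact mem_span hi

theorem rank_homog (pts : ι → Fin d → ℝ) {F : Finset ι} (hF : F.Nonempty) :
    rank (homog pts) F = finrank ℝ (vectorSpan ℝ (pts '' (F : Set ι))) + 1 := by
  obtain ⟨i, hi⟩ := hF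
  have h1 := Submodule.finrank_sup_add_finrank_inf_eq
    ((vectorSpan ℝ (pts '' (F : Set ι))).map (LinearMap.inl ℝ (Fin d → ℝ) ℝ))
    (span ℝ {homog pts i})
  have h2 : (vectorSpan ℝ (pts '' (F : Set ι))).map (LinearMap.inl ℝ (Fin d → ℝ) ℝ) ⊓
      span ℝ {homog pts i} = ⊥ := by
    rw [eq_bot_iff]
    rintro x ⟨⟨y, -, rfl⟩, hx⟩
    obtain ⟨c, hc⟩ := mem_span_singleton.1 hx
    have h0 : c = 0 := by simpa [homog] using congrArg Prod.snd hc
    rw [mem_bot, ← hc, h0, zero_smul]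
  have h3 : finrank ℝ ((vectorSpan ℝ (pts '' (F : Set ι))).map (LinearMap.inl ℝ (Fin d → ℝ) ℝ)) =
      finrank ℝ (vectorSpan ℝ (pts '' (F : Set ι))) :=
    (LinearEquiv.finrank_eq (Submodule.equivMapOfInjective _ LinearMap.inl_injective _)).symm
  have h4 : finrank ℝ (span ℝ {homog pts i}) = 1 :=
    finrank_span_singleton fun e => one_ne_zero (congrArg Prod.snd e)
  rw [h2, finrank_bot, h3, h4, add_zero] at h1
  unfold rank
  rw [span_homog pts hi, h1]

theorem isPointed_homog (pts : ι → Fin d → ℝ) (s : Finset ι) : IsPointed (homog pts) s :=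
  ⟨LinearMap.snd ℝ _ _, fun i _ _ => by simp [homog]⟩

theorem vectorSpan_convexHull (A : Set (Fin d → ℝ)) :
    vectorSpan ℝ (convexHull ℝ A) = vectorSpan ℝ A := by
  rw [← direction_affineSpan, affineSpan_convexHull, direction_affineSpan]

/-- A convex combination of nonnegative values vanishes only if every term with positive weight
does. -/
theorem Supports.of_mem_convexHull {pts : ι → Fin d → ℝ} {s F : Finset ι}
    {φ : Dual ℝ ((Fin d → ℝ) × ℝ)} (h : Supports (homog pts) s F φ) (hF : F ⊆ s)
    {x : Fin d → ℝ} (hx : x ∈ convexHull ℝ (pts '' (s : Set ι))) :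
    0 ≤ φ (x, 1) ∧ (φ (x, 1) = 0 ↔ x ∈ convexHull ℝ (pts '' (F : Set ι))) := by
  have hcomb : ∀ (x y : Fin d → ℝ) (a b : ℝ), a + b = 1 →
      φ (a • x + b • y, 1) = a * φ (x, 1) + b * φ (y, 1) := by
    intro x y a b hab
    have : ((a • x + b • y, 1) : (Fin d → ℝ) × ℝ) = a • (x, 1) + b • (y, 1) := by
      simp [hab]
    rw [this, map_add, map_smul, map_smul, smul_eq_mul, smul_eq_mul]
  have h1 : convexHull ℝ (pts '' (s : Set ι)) ⊆
      {x | 0 ≤ φ (x, 1) ∧ (φ (x, 1) = 0 → x ∈ convexHull ℝ (pts '' (F : Set ι)))} := by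
    refine convexHull_min ?_ ?_
    · rintro _ ⟨i, hi, rfl⟩
      exact ⟨(h i hi).1, fun e => subset_convexHull ℝ _ ⟨i, (h i hi).2.1 e, rfl⟩⟩
    · rw [convex_iff_forall_pos]
      rintro x ⟨hx, hx'⟩ y ⟨hy, hy'⟩ a b ha hb hab
      simp only [Set.mem_ofPred_eq]
      rw [hcomb x y a b hab]
      have e1 := mul_nonneg ha.le hx
      have e2 := mul_nonneg hb.le hy
      refine ⟨add_nonneg e1 e2, fun e => ?_⟩
      have e3 : a * φ (x, 1) = 0 := by linarith
      have e4 : b * φ (y, 1) = 0 := by linarith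
      exact convex_convexHull ℝ _ (hx' ((mul_eq_zero.1 e3).resolve_left ha.ne'))
        (hy' ((mul_eq_zero.1 e4).resolve_left hb.ne')) ha.le hb.le hab
  have h2 : convexHull ℝ (pts '' (F : Set ι)) ⊆ {x | φ (x, 1) = 0} := by
    refine convexHull_min ?_ ?_
    · rintro _ ⟨i, hi, rfl⟩
      exact h.zero_of_mem hF hi
    · intro x hx y hy a b ha hb hab
      simp only [Set.mem_ofPred_eq] at hx hy ⊢
      rw [hcomb x y a b hab, hx, hy]
      simp
  exact ⟨(h1 hx).1, (h1 hx).2, fun hm => h2 hm⟩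

/-- A linear functional `l` with maximum m on the polytope corresponds to the functional (x, t) ↦ m
t − l(x), nonnegative on the homogenized points and zero exactly over the exposed face. -/
theorem kFaces_convexHull (pts : ι → Fin d → ℝ) (s : Finset ι) (k : ℕ) :
    kFaces (convexHull ℝ (pts '' (s : Set ι))) k =
      (fun F : Finset ι => convexHull ℝ (pts '' (F : Set ι))) ''
        (faces (homog pts) s (k + 1) : Set (Finset ι)) := by
  ext B
  simp only [kFaces, Set.mem_ofPred_eq, Set.mem_image, Finset.mem_coe, mem_faces]
  constructor
  · rintro ⟨hne, hexp, hdim⟩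
    obtain ⟨l, hl⟩ := hexp hne
    obtain ⟨x₀, hx₀⟩ := id hne
    rw [hl] at hx₀
    obtain ⟨hx₀, hmax⟩ := hx₀
    let φ : Dual ℝ ((Fin d → ℝ) × ℝ) :=
      l x₀ • LinearMap.snd ℝ _ _ - (l : (Fin d → ℝ) →ₗ[ℝ] ℝ).comp (LinearMap.fst ℝ _ _)
    have hφ : ∀ x, φ (x, 1) = l x₀ - l x := fun x => by simp [φ]
    let F := s.filter fun i => φ (homog pts i) = 0
    have hsup : Supports (homog pts) s F φ := by
      intro i hi
      refine ⟨?_, by simp [F, hi]⟩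
      rw [homog, hφ]
      exact sub_nonneg.2 (hmax _ (subset_convexHull ℝ _ ⟨i, hi, rfl⟩))
    have hFs : F ⊆ s := Finset.filter_subset _ _
    have hB : convexHull ℝ (pts '' (F : Set ι)) = B := by
      rw [hl]
      ext x
      simp only [Set.mem_ofPred_eq]
      constructor
      · intro hx
        have hx' := convexHull_mono (Set.image_mono (by exact_mod_cast hFs)) hx
        have := (hsup.of_mem_convexHull hFs hx').2.2 hx
        rw [hφ] at this
        exact ⟨hx', fun y hy => (hmax y hy).trans (by linarith)⟩
      · rintro ⟨hx, hx'⟩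
        refine (hsup.of_mem_convexHull hFs hx).2.1 ?_
        rw [hφ]
        have := hmax x hx
        have := hx' x₀ hx₀
        linarith
    refine ⟨F, ⟨⟨hFs, φ, hsup⟩, ?_⟩, hB⟩
    have hFne : F.Nonempty := by
      rw [← hB, convexHull_nonempty_iff, Set.image_nonempty] at hne
      exact_mod_cast hne
    rw [rank_homog pts hFne, ← vectorSpan_convexHull, hB, hdim]
  · rintro ⟨F, ⟨⟨hFs, φ, hsup⟩, hr⟩, rfl⟩
    have hFne : F.Nonempty := by
      obtain ⟨i, hi, -⟩ := exists_ne_zero_of_rank_pos (v := homog pts) (F := F) (by omega)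
      exact ⟨i, hi⟩
    have hne : (convexHull ℝ (pts '' (F : Set ι))).Nonempty := by
      rw [convexHull_nonempty_iff, Set.image_nonempty]
      exact_mod_cast hFne
    refine ⟨hne, fun _ => ?_, ?_⟩
    · refine ⟨LinearMap.toContinuousLinearMap (-(φ.comp (LinearMap.inl ℝ _ _))), ?_⟩
      have hφ : ∀ x, φ (x, 1) = φ (0, 1) + φ (x, 0) := fun x => by
        rw [← map_add]; simp
      ext x
      simp only [Set.mem_ofPred_eq, LinearMap.coe_toContinuousLinearMap', LinearMap.neg_apply,
        LinearMap.comp_apply, LinearMap.inl_apply, neg_le_neg_iff]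
      constructor
      · intro hx
        have hx' := convexHull_mono (Set.image_mono (by exact_mod_cast hFs)) hx
        refine ⟨hx', fun y hy => ?_⟩
        have h1 := (hsup.of_mem_convexHull hFs hx').2.2 hx
        have h2 := (hsup.of_mem_convexHull hFs hy).1
        rw [hφ] at h1 h2
        linarith
      · rintro ⟨hx, hx'⟩
        refine (hsup.of_mem_convexHull hFs hx).2.1 (le_antisymm ?_ (hsup.of_mem_convexHull hFs hx).1)
        obtain ⟨y, hy⟩ := hne
        have hy' := convexHull_mono (Set.image_mono (by exact_mod_cast hFs)) hy
        have h1 := (hsup.of_mem_convexHull hFs hy').2.2 hy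
        have h2 := hx' y hy'
        rw [hφ] at h1 ⊢
        linarith
    · rw [vectorSpan_convexHull]
      have := rank_homog pts hFne
      omega

/-- The face numbers of the convex hull of a finite family of points. -/
theorem faceNumber_convexHull (pts : ι → Fin d → ℝ) (s : Finset ι) (k : ℕ) :
    faceNumber (convexHull ℝ (pts '' (s : Set ι))) k = (faces (homog pts) s (k + 1)).card := by
  unfold faceNumber
  rw [kFaces_convexHull, Set.InjOn.ncard_image, Set.ncard_coe_finset]
  intro F hF G hG e
  simp only [Finset.mem_coe, mem_faces] at hF hG e
  obtain ⟨⟨hFs, φ, hφ⟩, -⟩ := hF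
  obtain ⟨⟨hGs, ψ, hψ⟩, -⟩ := hG
  have hm : ∀ i ∈ s, pts i ∈ convexHull ℝ (pts '' (s : Set ι)) :=
    fun i hi => subset_convexHull ℝ _ ⟨i, hi, rfl⟩
  have key : ∀ i ∈ s, i ∈ F ↔ i ∈ G := by
    intro i hi
    have h1 := (hφ.of_mem_convexHull hFs (hm i hi)).2
    have h2 := (hψ.of_mem_convexHull hGs (hm i hi)).2
    have h3 := (hφ i hi).2
    have h4 := (hψ i hi).2
    rw [← h3, ← h4]
    simp only [homog]
    rw [h1, h2, e]
  ext i
  exact ⟨fun h => (key i (hFs h)).1 h, fun h => (key i (hGs h)).2 h⟩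

theorem isFullDimPolytope_convexHull {pts : ι → Fin d → ℝ} {s : Finset ι}
    (h : rank (homog pts) s = d + 1) :
    IsFullDimPolytope d (convexHull ℝ (pts '' (s : Set ι))) := by
  have hs : s.Nonempty := by
    obtain ⟨i, hi, -⟩ := exists_ne_zero_of_rank_pos (v := homog pts) (F := s) (by omega)
    exact ⟨i, hi⟩
  refine ⟨⟨s.image pts, by rw [Finset.coe_image]⟩, ?_, ?_⟩
  · rw [convexHull_nonempty_iff, Set.image_nonempty]
    exact_mod_cast hs
  · rw [vectorSpan_convexHull]
    have := rank_homog pts hs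
    omega

theorem exists_config_of_isFullDimPolytope {P : Set (Fin d → ℝ)} (hP : IsFullDimPolytope d P) :
    ∃ s : Finset (Fin d → ℝ), P = convexHull ℝ (id '' (s : Set (Fin d → ℝ))) ∧
      rank (homog id) s = d + 1 := by
  obtain ⟨⟨s, hs⟩, hne, hd⟩ := hP
  refine ⟨s, by rw [hs, Set.image_id], ?_⟩
  rw [rank_homog, Set.image_id, ← vectorSpan_convexHull, ← hs, hd]
  rw [hs, convexHull_nonempty_iff] at hne
  exact_mod_cast hne

end VectorConfig

/-! ### Constraints on the face numbers of four-dimensional polytopes -/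

open VectorConfig in
/-- Inequalities between the face numbers of a four-dimensional polytope. -/
theorem IsFullDimPolytope.faceNumber_le {P : Set (Fin 4 → ℝ)} (hP : IsFullDimPolytope 4 P) :
    faceNumber P 2 + 2 * faceNumber P 0 ≤ 2 * faceNumber P 1 ∧
      faceNumber P 1 ≤ (faceNumber P 0).choose 2 := by
  obtain ⟨s, rfl, hs⟩ := exists_config_of_isFullDimPolytope hP
  simp only [faceNumber_convexHull]
  exact ⟨card_faces_three_add_le (isPointed_homog id s) hs,
    card_faces_two_le_choose (isPointed_homog id s)⟩

theorem mem_facePairSet_iff {x : Fin 2 → ℝ} : x ∈ facePairSet 4 1 2 ↔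
    ∃ P, IsFullDimPolytope 4 P ∧ x = ![(faceNumber P 1 : ℝ), (faceNumber P 2 : ℝ)] := by
  constructor
  · rintro ⟨f, ⟨P, hP, hf⟩, rfl⟩
    refine ⟨P, hP, ?_⟩
    simp only [hf]
    rfl
  · rintro ⟨P, hP, rfl⟩
    exact ⟨fun k => faceNumber P k, ⟨P, hP, fun k => rfl⟩, rfl⟩

/-- Pairs with an odd number of ridges just beyond the extremal ones do not occur. -/
theorem notMem_facePairSet (l : ℕ) :
    ![8 * (l : ℝ) ^ 2 + 19 * l + 12, 16 * (l : ℝ) ^ 2 + 30 * l + 13] ∉ facePairSet 4 1 2 := by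
  rw [mem_facePairSet_iff]
  rintro ⟨P, hP, e⟩
  have e1 := congrFun e 0
  have e2 := congrFun e 1
  simp only [Matrix.cons_val_zero, Matrix.cons_val_one] at e1 e2
  have e1' : faceNumber P 1 = 8 * l ^ 2 + 19 * l + 12 := by exact_mod_cast e1.symm
  have e2' : faceNumber P 2 = 16 * l ^ 2 + 30 * l + 13 := by exact_mod_cast e2.symm
  obtain ⟨h1, h2⟩ := hP.faceNumber_le
  -- The inequality reads 2f₀ ≤ 8l + 11, and rounding down gives 4l + 5. But C(4l + 5, 2) = 8l² +
  -- 18l + 10 is less than f₁.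
  have h3 : faceNumber P 0 ≤ 4 * l + 5 := by omega
  have h4 := h2.trans (Nat.choose_le_choose 2 h3)
  rw [Nat.choose_two_right, e1'] at h4
  have h5 : (4 * l + 5) * (4 * l + 5 - 1) = 2 * (8 * l ^ 2 + 18 * l + 10) := by
    rw [show 4 * l + 5 - 1 = 4 * l + 4 by omega]
    ring
  rw [h5] at h4
  omega

/-! ### Semi-algebraic sets along polynomial curves -/

open Filter in
theorem Polynomial.eventually_sign_atTop (q : Polynomial ℝ) :
    (∀ᶠ t in atTop, q.eval t < 0) ∨ (∀ᶠ t in atTop, q.eval t = 0) ∨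
      ∀ᶠ t in atTop, 0 < q.eval t := by
  rcases lt_or_ge 0 q.degree with hd | hd
  · rcases le_total 0 q.leadingCoeff with h | h
    · exact Or.inr (Or.inr ((q.tendsto_atTop_of_leadingCoeff_nonneg hd h).eventually_gt_atTop 0))
    · exact Or.inl ((q.tendsto_atBot_of_leadingCoeff_nonpos hd h).eventually_lt_atBot 0)
  · rw [Polynomial.eq_C_of_degree_le_zero hd]
    simp only [Polynomial.eval_C]
    rcases lt_trichotomy (q.coeff 0) 0 with h | h | h
    · exact Or.inl (.of_forall fun _ => h)
    · exact Or.inr (Or.inl (.of_forall fun _ => h))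
    · exact Or.inr (Or.inr (.of_forall fun _ => h))

section EventuallyDecided

open Filter

/-- A predicate that eventually holds, or eventually fails. -/
def EventuallyDecided (p : ℝ → Prop) : Prop :=
  (∀ᶠ t in atTop, p t) ∨ ∀ᶠ t in atTop, ¬ p t

theorem EventuallyDecided.and {p q : ℝ → Prop} (hp : EventuallyDecided p)
    (hq : EventuallyDecided q) : EventuallyDecided fun t => p t ∧ q t := by
  rcases hp with hp | hp
  · rcases hq with hq | hq
    · exact Or.inl (hp.and hq)
    · exact Or.inr (hq.mono fun t h h' => h h'.2)
  · exact Or.inr (hp.mono fun t h h' => h h'.1)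

theorem EventuallyDecided.not {p : ℝ → Prop} (hp : EventuallyDecided p) :
    EventuallyDecided fun t => ¬ p t := by
  rcases hp with hp | hp
  · exact Or.inr (hp.mono fun t h h' => h' h)
  · exact Or.inl hp

theorem EventuallyDecided.forall_mem {α : Type*} {E : Set α} (hE : E.Finite) {p : α → ℝ → Prop}
    (h : ∀ a ∈ E, EventuallyDecided (p a)) : EventuallyDecided fun t => ∀ a ∈ E, p a t := by
  by_cases hall : ∀ a ∈ E, ∀ᶠ t in atTop, p a t
  · exact Or.inl ((eventually_all_finite hE).2 hall)
  · push Not at hall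
    obtain ⟨a, ha, hn⟩ := hall
    refine Or.inr (((h a ha).resolve_left (not_eventually.2 hn)).mono fun t ht hc => ht (hc a ha))

theorem EventuallyDecided.exists_mem {α : Type*} {E : Set α} (hE : E.Finite) {p : α → ℝ → Prop}
    (h : ∀ a ∈ E, EventuallyDecided (p a)) : EventuallyDecided fun t => ∃ a ∈ E, p a t := by
  have := (EventuallyDecided.forall_mem hE fun a ha => (h a ha).not).not
  simpa using this

theorem MvPolynomial.eval_polynomial_curve {d : ℕ} (γ : Fin d → Polynomial ℝ)
    (p : MvPolynomial (Fin d) ℝ) (t : ℝ) :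
    MvPolynomial.eval (fun i => (γ i).eval t) p = (MvPolynomial.aeval γ p).eval t := by
  induction p using MvPolynomial.induction_on with
  | C a => simp
  | add p q hp hq => simp [hp, hq]
  | mul_X p i hp => simp [hp]

/-- A polynomial curve eventually stays inside or outside a semi-algebraic set. -/
theorem IsSemialgebraic.eventuallyDecided {d : ℕ} {S : Set (Fin d → ℝ)} (hS : IsSemialgebraic S)
    (γ : Fin d → Polynomial ℝ) : EventuallyDecided fun t => (fun i => (γ i).eval t) ∈ S := by
  obtain ⟨B, hB, hbasic, rfl⟩ := hS
  simp only [Set.mem_sUnion]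
  refine EventuallyDecided.exists_mem hB fun T hT => ?_
  obtain ⟨E, N, P, rfl⟩ := hbasic T hT
  simp only [Set.mem_ofPred_eq, MvPolynomial.eval_polynomial_curve]
  refine .and (.forall_mem E.finite_toSet fun p _ => ?_)
    (.and (.forall_mem N.finite_toSet fun p _ => ?_) (.forall_mem P.finite_toSet fun p _ => ?_))
  all_goals
    rcases (MvPolynomial.aeval γ p).eventually_sign_atTop with h | h | h
  · exact Or.inr (h.mono fun t h => h.ne)
  · exact Or.inl h
  · exact Or.inr (h.mono fun t h => h.ne')
  · exact Or.inr (h.mono fun t h => h.not_ge)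
  · exact Or.inl (h.mono fun t h => h.ge)
  · exact Or.inl (h.mono fun t h => h.le)
  · exact Or.inr (h.mono fun t h => h.not_gt)
  · exact Or.inr (h.mono fun t h => h.not_gt)
  · exact Or.inl h

end EventuallyDecided

/-! ### Functionals on homogenized four-dimensional space -/

namespace VectorConfig

open Module Submodule
open scoped Classical

variable {ι : Type*}

/-- The affine functional with constant term `c` and linear coefficients `a`. -/
noncomputable def affineDual (c : ℝ) (a : Fin 4 → ℝ) : Dual ℝ ((Fin 4 → ℝ) × ℝ) :=
  (∑ i, a i • LinearMap.proj i).comp (LinearMap.fst ℝ _ _) + c • LinearMap.snd ℝ _ _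

theorem affineDual_homog (c : ℝ) (a : Fin 4 → ℝ) (pts : ι → Fin 4 → ℝ) (i : ι) :
    affineDual c a (homog pts i) =
      c + a 0 * pts i 0 + a 1 * pts i 1 + a 2 * pts i 2 + a 3 * pts i 3 := by
  simp [affineDual, homog, Fin.sum_univ_four]
  ring

theorem exists_eq_affineDual (φ : Dual ℝ ((Fin 4 → ℝ) × ℝ)) : ∃ c a, φ = affineDual c a := by
  refine ⟨φ (0, 1), fun i => φ (Pi.single i 1, 0), ?_⟩
  ext i
  · simp [affineDual, Pi.single_apply]
  · simp [affineDual]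

theorem affineDual_eq_zero {c : ℝ} {a : Fin 4 → ℝ} (hc : c = 0) (h0 : a 0 = 0) (h1 : a 1 = 0)
    (h2 : a 2 = 0) (h3 : a 3 = 0) : affineDual c a = 0 := by
  simp [affineDual, Fin.sum_univ_four, *]

/-- Subfamilies of a basis are independent. -/
theorem rank_eq_card_of_subset {V : Type*} [AddCommGroup V] [Module ℝ V] [FiniteDimensional ℝ V]
    {v : ι → V} {B F : Finset ι} (h : ∀ φ : Dual ℝ V, (∀ i ∈ B, φ (v i) = 0) → φ = 0)
    (hB : B.card = finrank ℝ V) (hF : F ⊆ B) : rank v F = F.card :=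
  rank_eq_card (s := B) (fun G hG hc => by rwa [Finset.eq_of_subset_of_card_le hG (by omega)])
    hB.ge hF (hB ▸ Finset.card_le_card hF)

theorem finrank_homog_space : finrank ℝ ((Fin 4 → ℝ) × ℝ) = 5 := by simp

/-! ### The pyramid over a triangular bipyramid -/

/-- The vertices of the pyramid over the bipyramid over a triangle. -/
noncomputable def bipyramidPts : Fin 6 → Fin 4 → ℝ :=
  ![![1, 0, 0, 0], ![0, 1, 0, 0], ![-1, -1, 0, 0], ![0, 0, 1, 0], ![0, 0, -1, 0], ![0, 0, 0, 1]]

/-- Omitting either apex of the bipyramid leaves the vertices of a 4-simplex. -/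
theorem bipyramid_rank {F : Finset (Fin 6)} (hF : ¬ {3, 4} ⊆ F) :
    rank (homog bipyramidPts) F = F.card := by
  have h : (3 : Fin 6) ∉ F ∨ (4 : Fin 6) ∉ F := by
    by_contra! hc
    exact hF (by simp [Finset.insert_subset_iff, hc])
  rcases h with h | h
  · refine rank_eq_card_of_subset (B := {0, 1, 2, 4, 5}) ?_ ?_ ?_
    · intro φ hφ
      obtain ⟨c, a, rfl⟩ := exists_eq_affineDual φ
      simp only [Finset.mem_insert, Finset.mem_singleton, forall_eq_or_imp, forall_eq,
        affineDual_homog, bipyramidPts] at hφ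
      simp at hφ
      obtain ⟨h0, h1, h2, h3, h4⟩ := hφ
      apply affineDual_eq_zero <;> linarith
    · rw [finrank_homog_space]; rfl
    · intro i hi
      have : i ≠ 3 := fun e => h (e ▸ hi)
      revert this; revert i; decide +revert
  · refine rank_eq_card_of_subset (B := {0, 1, 2, 3, 5}) ?_ ?_ ?_
    · intro φ hφ
      obtain ⟨c, a, rfl⟩ := exists_eq_affineDual φ
      simp only [Finset.mem_insert, Finset.mem_singleton, forall_eq_or_imp, forall_eq,
        affineDual_homog, bipyramidPts] at hφ
      simp at hφ
      obtain ⟨h0, h1, h2, h3, h4⟩ := hφ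
      apply affineDual_eq_zero <;> linarith
    · rw [finrank_homog_space]; rfl
    · intro i hi
      have : i ≠ 4 := fun e => h (e ▸ hi)
      fin_cases i <;> simp_all

theorem bipyramid_isFace {F : Finset (Fin 6)} (h1 : ¬ {0, 1, 2} ⊆ F) (h2 : ¬ {3, 4} ⊆ F) :
    IsFace (homog bipyramidPts) Finset.univ F := by
  let b : Fin 6 → ℝ := fun i => if i ∈ F then 0 else 1
  have hb0 : ∀ i, 0 ≤ b i := fun i => by simp only [b]; split_ifs <;> norm_num
  have hbF : ∀ i, b i = 0 ↔ i ∈ F := fun i => by simp only [b]; split_ifs with h <;> simp [h]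
  have hx : 0 < b 0 + b 1 + b 2 := by
    by_contra! hle
    have := hb0 0; have := hb0 1; have := hb0 2
    refine h1 ?_
    simp only [Finset.insert_subset_iff, Finset.singleton_subset_iff, ← hbF]
    refine ⟨?_, ?_, ?_⟩ <;> linarith
  have hy : 0 < b 3 + b 4 := by
    by_contra! hle
    have := hb0 3; have := hb0 4
    refine h2 ?_
    simp only [Finset.insert_subset_iff, Finset.singleton_subset_iff, ← hbF]
    refine ⟨?_, ?_⟩ <;> linarith
  set X := b 0 + b 1 + b 2 with hX
  set Y := b 3 + b 4 with hY
  -- The values `w i * b i` must satisfy the affine dependence 2(p₀ + p₁ + p₂) = 3(p₃ + p₄) of the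
  -- vertices; with these weights both sides equal 6XY.
  let w : Fin 6 → ℝ := ![3 * Y, 3 * Y, 3 * Y, 2 * X, 2 * X, 1]
  have hw : ∀ i, 0 < w i := by
    intro i
    fin_cases i <;> simp [w] <;> positivity
  refine ⟨Finset.subset_univ _, affineDual (X * Y)
    ![3 * Y * b 0 - X * Y, 3 * Y * b 1 - X * Y, 2 * X * b 3 - X * Y, b 5 - X * Y], ?_⟩
  have hval : ∀ i, affineDual (X * Y) ![3 * Y * b 0 - X * Y, 3 * Y * b 1 - X * Y,
      2 * X * b 3 - X * Y, b 5 - X * Y] (homog bipyramidPts i) = w i * b i := by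
    intro i
    rw [affineDual_homog]
    fin_cases i <;> simp [bipyramidPts, w]
    · rw [hX]; ring
    · rw [hY]; ring
  intro i _
  rw [hval, mul_eq_zero, or_iff_right (hw i).ne', hbF]
  exact ⟨mul_nonneg (hw i).le (hb0 i), Iff.rfl⟩

theorem bipyramid_faces {r : ℕ} (hr : r ≤ 3) : faces (homog bipyramidPts) Finset.univ r =
    (Finset.powersetCard r Finset.univ).filter fun F => ¬ {0, 1, 2} ⊆ F ∧ ¬ {3, 4} ⊆ F := by
  ext F
  rw [mem_faces, Finset.mem_filter, Finset.mem_powersetCard]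
  constructor
  · rintro ⟨⟨hFs, φ, hφ⟩, hrk⟩
    have hnot : ¬ ({0, 1, 2, 3, 4} : Finset (Fin 6)) ⊆ F := by
      intro hsub
      have h1 : rank (homog bipyramidPts) {0, 1, 2, 3} = 4 := bipyramid_rank (by decide)
      have h2 : ({0, 1, 2, 3} : Finset (Fin 6)) ⊆ F := Finset.Subset.trans (by decide) hsub
      have := rank_mono (v := homog bipyramidPts) h2
      omega
    -- By nonnegativity, a face containing the triangle or both apices contains all five points of
    -- the bipyramid, whose rank is too large.
    have hrel : 2 * (φ (homog bipyramidPts 0) + φ (homog bipyramidPts 1) +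
        φ (homog bipyramidPts 2)) = 3 * (φ (homog bipyramidPts 3) + φ (homog bipyramidPts 4)) := by
      obtain ⟨c, a, rfl⟩ := exists_eq_affineDual φ
      simp only [affineDual_homog, bipyramidPts]
      simp
      ring
    have hn := fun i => (hφ i (Finset.mem_univ i)).1
    have n0 := hn 0; have n1 := hn 1; have n2 := hn 2; have n3 := hn 3; have n4 := hn 4
    have hz := fun i => (hφ i (Finset.mem_univ i)).2
    simp only [Finset.insert_subset_iff, Finset.singleton_subset_iff, ← hz] at hnot ⊢
    have hy : ¬ (φ (homog bipyramidPts 3) = 0 ∧ φ (homog bipyramidPts 4) = 0) := by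
      rintro ⟨e3, e4⟩
      refine hnot ⟨?_, ?_, ?_, e3, e4⟩ <;> linarith
    have hx : ¬ (φ (homog bipyramidPts 0) = 0 ∧ φ (homog bipyramidPts 1) = 0 ∧
        φ (homog bipyramidPts 2) = 0) := by
      rintro ⟨e0, e1, e2⟩
      refine hnot ⟨e0, e1, e2, ?_, ?_⟩ <;> linarith
    refine ⟨⟨hFs, ?_⟩, hx, hy⟩
    rw [← hrk, bipyramid_rank]
    simpa [Finset.insert_subset_iff, ← hz] using hy
  · rintro ⟨⟨-, hc⟩, h1, h2⟩
    exact ⟨bipyramid_isFace h1 h2, by rw [bipyramid_rank h2, hc]⟩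

theorem bipyramid_rank_univ : rank (homog bipyramidPts) Finset.univ = 5 := by
  have h1 : rank (homog bipyramidPts) {0, 1, 2, 3, 5} = 5 := bipyramid_rank (by decide)
  have h2 := rank_mono (v := homog bipyramidPts) (Finset.subset_univ {0, 1, 2, 3, 5})
  have h3 : rank (homog bipyramidPts) Finset.univ ≤ 5 := by
    rw [← finrank_homog_space]
    exact Submodule.finrank_le _
  omega

theorem bipyramid_card_faces_two : (faces (homog bipyramidPts) Finset.univ 2).card = 14 := by
  rw [bipyramid_faces (by norm_num)]
  have : ((Finset.powersetCard 2 (Finset.univ : Finset (Fin 6))).filter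
      fun F => ¬ {0, 1, 2} ⊆ F ∧ ¬ {3, 4} ⊆ F).card = 14 := by decide
  convert this

theorem bipyramid_card_faces_three : (faces (homog bipyramidPts) Finset.univ 3).card = 15 := by
  rw [bipyramid_faces (by norm_num)]
  have : ((Finset.powersetCard 3 (Finset.univ : Finset (Fin 6))).filter
      fun F => ¬ {0, 1, 2} ⊆ F ∧ ¬ {3, 4} ⊆ F).card = 15 := by decide
  convert this

end VectorConfig

open VectorConfig in
theorem mem_facePairSet_of_config {ι : Type*} {pts : ι → Fin 4 → ℝ} {s : Finset ι}
    (h : rank (homog pts) s = 5) :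
    ![((faces (homog pts) s 2).card : ℝ), ((faces (homog pts) s 3).card : ℝ)] ∈
      facePairSet 4 1 2 := by
  rw [mem_facePairSet_iff]
  refine ⟨_, isFullDimPolytope_convexHull h, ?_⟩
  rw [faceNumber_convexHull, faceNumber_convexHull]

open VectorConfig in
theorem bipyramid_mem_facePairSet : ![(14 : ℝ), 15] ∈ facePairSet 4 1 2 := by
  have := mem_facePairSet_of_config bipyramid_rank_univ
  rw [bipyramid_card_faces_two, bipyramid_card_faces_three] at this
  exact_mod_cast this

/-! ### Simplicial polytopes with few missing edges -/

namespace VectorConfig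

open Module Submodule Polynomial
open scoped Classical

theorem coeff_eq_zero_of_roots {T : Finset ℤ} {c a₀ a₁ a₂ a₃ : ℝ} (hT : T.card = 5)
    (h : ∀ t ∈ T, c + a₀ * t + a₁ * t ^ 2 + a₂ * t ^ 3 + a₃ * t ^ 4 = 0) :
    c = 0 ∧ a₀ = 0 ∧ a₁ = 0 ∧ a₂ = 0 ∧ a₃ = 0 := by
  let p : ℝ[X] := C a₃ * X ^ 4 + C a₂ * X ^ 3 + C a₁ * X ^ 2 + C a₀ * X + C c
  have hdeg : p.natDegree < (T.image (Int.cast : ℤ → ℝ)).card := by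
    rw [Finset.card_image_of_injective _ Int.cast_injective, hT]
    have : p.natDegree ≤ 4 := by simp only [p]; compute_degree
    omega
  have hp : p = 0 := by
    refine Polynomial.eq_zero_of_natDegree_lt_card_of_eval_eq_zero' p _ ?_ hdeg
    intro x hx
    obtain ⟨t, ht, rfl⟩ := Finset.mem_image.1 hx
    simp only [p, eval_add, eval_mul, eval_C, eval_pow, eval_X]
    linarith [h t ht]
  have hc := fun n => congrArg (fun q : ℝ[X] => q.coeff n) hp
  have h0 := hc 0; have h1 := hc 1; have h2 := hc 2; have h3 := hc 3; have h4 := hc 4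
  simp [p, coeff_X, coeff_C, coeff_X_pow] at h0 h1 h2 h3 h4
  exact ⟨h0, h1, h2, h3, h4⟩

theorem cubic_coeff_eq_zero_of_roots {T : Finset ℤ} {c a₀ a₁ a₂ : ℝ} (hT : T.card = 4)
    (h : ∀ t ∈ T, c + a₀ * t + a₁ * t ^ 2 + a₂ * t ^ 3 = 0) :
    c = 0 ∧ a₀ = 0 ∧ a₁ = 0 ∧ a₂ = 0 := by
  let p : ℝ[X] := C a₂ * X ^ 3 + C a₁ * X ^ 2 + C a₀ * X + C c
  have hdeg : p.natDegree < (T.image (Int.cast : ℤ → ℝ)).card := by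
    rw [Finset.card_image_of_injective _ Int.cast_injective, hT]
    have : p.natDegree ≤ 3 := by simp only [p]; compute_degree
    omega
  have hp : p = 0 := by
    refine Polynomial.eq_zero_of_natDegree_lt_card_of_eval_eq_zero' p _ ?_ hdeg
    intro x hx
    obtain ⟨t, ht, rfl⟩ := Finset.mem_image.1 hx
    simp only [p, eval_add, eval_mul, eval_C, eval_pow, eval_X]
    linarith [h t ht]
  have hc := fun n => congrArg (fun q : ℝ[X] => q.coeff n) hp
  have h0 := hc 0; have h1 := hc 1; have h2 := hc 2; have h3 := hc 3
  simp [p, coeff_X, coeff_C, coeff_X_pow] at h0 h1 h2 h3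
  exact ⟨h0, h1, h2, h3⟩

/-- Integer points on the moment curve, and the point `none` at height `h` on the last axis. -/
noncomputable def momentPts (h : ℝ) : Option ℤ → Fin 4 → ℝ
  | none => ![0, 0, 0, h]
  | some t => ![t, t ^ 2, t ^ 3, t ^ 4]

theorem affineDual_momentPts_none (c : ℝ) (a : Fin 4 → ℝ) (h : ℝ) :
    affineDual c a (homog (momentPts h) none) = c + a 3 * h := by
  simp [affineDual_homog, momentPts]

theorem affineDual_momentPts_some (c : ℝ) (a : Fin 4 → ℝ) (h : ℝ) (t : ℤ) :
    affineDual c a (homog (momentPts h) (some t)) =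
      c + a 0 * t + a 1 * t ^ 2 + a 2 * t ^ 3 + a 3 * t ^ 4 := by
  simp [affineDual_homog, momentPts]

theorem generalPosition_momentPts {h : ℝ} (hh : ∀ z : ℤ, h ≠ z) {F : Finset (Option ℤ)}
    (hF : F.card = 5) (φ : Dual ℝ ((Fin 4 → ℝ) × ℝ))
    (hφ : ∀ i ∈ F, φ (homog (momentPts h) i) = 0) : φ = 0 := by
  obtain ⟨c, a, rfl⟩ := exists_eq_affineDual φ
  have hT : ∀ t ∈ Finset.eraseNone F,
      c + a 0 * t + a 1 * t ^ 2 + a 2 * t ^ 3 + a 3 * t ^ 4 = 0 := by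
    intro t ht
    rw [← affineDual_momentPts_some c a h]
    exact hφ _ (Finset.mem_eraseNone.1 ht)
  by_cases hn : none ∈ F
  · have hcard : (Finset.eraseNone F).card = 4 := by
      have := congrArg Finset.card (Finset.map_some_eraseNone F)
      rw [Finset.card_map, Finset.card_erase_of_mem hn, hF] at this
      simpa using this
    have hq := hφ _ hn
    rw [affineDual_momentPts_none] at hq
    obtain ⟨w, x, y, z, -, -, -, -, -, -, e⟩ := Finset.card_eq_four.1 hcard
    -- Subtracting a₃(t − w)(t − x)(t − y)(t − z) leaves a cubic with four roots, hence zero, so the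
    -- constant term is a₃wxyz. The condition at the apex becomes a₃(wxyz + h) = 0, and `h` is not
    -- an integer.
    have hcub := cubic_coeff_eq_zero_of_roots (T := Finset.eraseNone F)
      (c := c - a 3 * (w * x * y * z))
      (a₀ := a 0 + a 3 * (w * x * y + w * x * z + w * y * z + x * y * z))
      (a₁ := a 1 - a 3 * (w * x + w * y + w * z + x * y + x * z + y * z))
      (a₂ := a 2 + a 3 * (w + x + y + z)) hcard ?_
    · obtain ⟨e0, e1, e2, e3⟩ := hcub
      have h3 : a 3 * (h + ((w * x * y * z : ℤ) : ℝ)) = 0 := by push_cast; linarith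
      have h3' : a 3 = 0 := by
        refine (mul_eq_zero.1 h3).resolve_right fun e => hh (-(w * x * y * z)) ?_
        push_cast at e ⊢
        linarith
      rw [h3'] at e0 e1 e2 e3
      apply affineDual_eq_zero <;> linarith
    · intro t ht
      have hprod : ((t : ℝ) - w) * (t - x) * (t - y) * (t - z) = 0 := by
        rw [e] at ht
        simp only [Finset.mem_insert, Finset.mem_singleton] at ht
        rcases ht with rfl | rfl | rfl | rfl <;> ring
      linear_combination hT t ht - a 3 * hprod
  · have hcard : (Finset.eraseNone F).card = 5 := by
      have := congrArg Finset.card (Finset.map_some_eraseNone F)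
      rwa [Finset.card_map, Finset.erase_eq_of_notMem hn, hF] at this
    obtain ⟨e, e0, e1, e2, e3⟩ := coeff_eq_zero_of_roots hcard hT
    exact affineDual_eq_zero e e0 e1 e2 e3

/-- The functional given by the quartic polynomial `(t² + b t + c) (t² + b' t + c')`. -/
noncomputable def quarticDual (b c b' c' : ℝ) : Dual ℝ ((Fin 4 → ℝ) × ℝ) :=
  affineDual (c * c') ![b * c' + b' * c, c + c' + b * b', b + b', 1]

theorem quarticDual_none (b c b' c' h : ℝ) :
    quarticDual b c b' c' (homog (momentPts h) none) = c * c' + h := by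
  simp [quarticDual, affineDual_momentPts_none]

theorem quarticDual_some (b c b' c' h : ℝ) (t : ℤ) :
    quarticDual b c b' c' (homog (momentPts h) (some t)) =
      (t ^ 2 + b * t + c) * (t ^ 2 + b' * t + c') := by
  simp [quarticDual, affineDual_momentPts_some]
  ring

/-! ### The family with 4l + 4 vertices and l missing edges -/

section Family

variable (l : ℕ)

/-- The parameters of the chosen points on the moment curve. -/
noncomputable def nodes : Finset ℤ := insert (-1) (insert 1 (Finset.Icc (l : ℤ) (5 * l)))

/-- The height of the additional vertex. -/
noncomputable def apexHeight : ℝ := 4 * (l : ℝ) ^ 2 - 1 / 2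

/-- The vertices of the polytope. -/
noncomputable def vertexIdx : Finset (Option ℤ) := Finset.insertNone (nodes l)

/-- The homogenized vertices of the polytope. -/
noncomputable def vertexVec : Option ℤ → (Fin 4 → ℝ) × ℝ := homog (momentPts (apexHeight l))

variable {l}

theorem mem_nodes {t : ℤ} : t ∈ nodes l ↔ t = -1 ∨ t = 1 ∨ (l : ℤ) ≤ t ∧ t ≤ 5 * l := by
  simp [nodes]

theorem none_mem_vertexIdx : none ∈ vertexIdx l := by simp [vertexIdx]

theorem some_mem_vertexIdx {t : ℤ} : some t ∈ vertexIdx l ↔ t ∈ nodes l := by simp [vertexIdx]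

theorem card_vertexIdx (hl : 2 ≤ l) : (vertexIdx l).card = 4 * l + 4 := by
  rw [vertexIdx, Finset.card_insertNone, nodes, Finset.card_insert_of_notMem,
    Finset.card_insert_of_notMem, Int.card_Icc]
  · omega
  · simp; omega
  · simp; omega

theorem apexHeight_ne_int (z : ℤ) : apexHeight l ≠ z := by
  intro e
  unfold apexHeight at e
  have : 8 * (l : ℤ) ^ 2 - 1 = 2 * z := by
    have : 8 * (l : ℝ) ^ 2 - 1 = 2 * z := by linarith
    exact_mod_cast this
  omega

theorem isSimplicial_vertexVec (hl : 2 ≤ l) : IsSimplicial (vertexVec l) (vertexIdx l) 5 := by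
  have := isSimplicial_of_generalPosition (v := vertexVec l) (s := vertexIdx l)
    (fun F _ hF φ hφ => generalPosition_momentPts apexHeight_ne_int
      (by rwa [finrank_homog_space] at hF) φ hφ)
    (by rw [finrank_homog_space, card_vertexIdx hl]; omega)
  rwa [finrank_homog_space] at this

theorem rank_vertexVec (hl : 2 ≤ l) {F : Finset (Option ℤ)} (hF : F ⊆ vertexIdx l)
    (hc : F.card ≤ 5) : rank (vertexVec l) F = F.card :=
  rank_eq_card (v := vertexVec l) (s := vertexIdx l)
    (fun F _ hF φ hφ => generalPosition_momentPts apexHeight_ne_int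
      (by rwa [finrank_homog_space] at hF) φ hφ)
    (by rw [finrank_homog_space, card_vertexIdx hl]; omega) hF
    (by rwa [finrank_homog_space])

theorem rank_vertexVec_self (hl : 2 ≤ l) : rank (vertexVec l) (vertexIdx l) = 5 := by
  obtain ⟨F, hF, hc⟩ := Finset.exists_subset_card_eq (s := vertexIdx l) (n := 5)
    (by rw [card_vertexIdx hl]; omega)
  have h1 := rank_vertexVec hl hF hc.le
  have h2 := rank_mono (v := vertexVec l) hF
  have h3 : rank (vertexVec l) (vertexIdx l) ≤ 5 := by
    rw [← finrank_homog_space]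
    exact Submodule.finrank_le _
  omega

theorem faces_vertexVec (hl : 2 ≤ l) {r : ℕ} (hr : r < 5) :
    faces (vertexVec l) (vertexIdx l) r =
      (Finset.powersetCard r (vertexIdx l)).filter (IsFace (vertexVec l) (vertexIdx l)) := by
  ext F
  rw [mem_faces, Finset.mem_filter, Finset.mem_powersetCard]
  constructor
  · rintro ⟨h1, h2⟩
    exact ⟨⟨h1.1, by rw [isSimplicial_vertexVec hl F h1 (by omega), h2]⟩, h1⟩
  · rintro ⟨⟨h1, h2⟩, h3⟩
    exact ⟨h3, by rw [rank_vertexVec hl h1 (by omega), h2]⟩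

theorem isFace_of_quartic {F : Finset (Option ℤ)} (hF : F ⊆ vertexIdx l) (b c b' c' : ℝ)
    (hn : 0 ≤ c * c' + apexHeight l) (hn' : c * c' + apexHeight l = 0 ↔ none ∈ F)
    (hs : ∀ t ∈ nodes l, 0 ≤ ((t : ℝ) ^ 2 + b * t + c) * (t ^ 2 + b' * t + c') ∧
      (((t : ℝ) ^ 2 + b * t + c) * (t ^ 2 + b' * t + c') = 0 ↔ some t ∈ F)) :
    IsFace (vertexVec l) (vertexIdx l) F := by
  refine ⟨hF, quarticDual b c b' c', ?_⟩
  rintro (_ | t) ht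
  · rw [vertexVec, quarticDual_none]
    exact ⟨hn, hn'⟩
  · rw [vertexVec, quarticDual_some]
    exact hs t (some_mem_vertexIdx.1 ht)

theorem apexHeight_pos (hl : 2 ≤ l) : 0 < apexHeight l := by
  have : (2 : ℝ) ≤ l := by exact_mod_cast hl
  unfold apexHeight
  nlinarith

theorem one_le_sq_of_mem_nodes (hl : 2 ≤ l) {t : ℤ} (ht : t ∈ nodes l) : (1 : ℝ) ≤ (t : ℝ) ^ 2 := by
  have : (1 : ℤ) ≤ t ^ 2 := by
    rcases mem_nodes.1 ht with rfl | rfl | h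
    · norm_num
    · norm_num
    · have : (2 : ℤ) ≤ t := by omega
      nlinarith
  exact_mod_cast this

/-- The quartic is (t − x)²(t − y)², and its value x²y² + h at the apex is positive. The case x = y
shows that single nodes are vertices. -/
theorem isFace_pair (hl : 2 ≤ l) {x y : ℤ} (hx : x ∈ nodes l) (hy : y ∈ nodes l) :
    IsFace (vertexVec l) (vertexIdx l) {some x, some y} := by
  have hp := apexHeight_pos hl
  have hpos : 0 < (x : ℝ) ^ 2 * (y : ℝ) ^ 2 + apexHeight l := by positivity
  refine isFace_of_quartic ?_ (-2 * x) (x ^ 2) (-2 * y) (y ^ 2) hpos.le ?_ ?_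
  · simp [Finset.insert_subset_iff, some_mem_vertexIdx, hx, hy]
  · simpa using hpos.ne'
  · intro t _
    have e : ((t : ℝ) ^ 2 + -2 * x * t + x ^ 2) * (t ^ 2 + -2 * y * t + y ^ 2) =
        (t - x) ^ 2 * (t - y) ^ 2 := by ring
    rw [e]
    refine ⟨by positivity, ?_⟩
    simp [sub_eq_zero]

/-- A half-integer near `2 l`, hence not a node. -/
noncomputable def doublePoint (l : ℕ) : ℝ := 2 * l + 1 / 2

theorem sub_doublePoint_ne_zero (t : ℤ) : (t : ℝ) - doublePoint l ≠ 0 := by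
  intro e
  unfold doublePoint at e
  have : 2 * t = 4 * (l : ℤ) + 1 := by
    have : 2 * (t : ℝ) = 4 * l + 1 := by linarith
    exact_mod_cast this
  omega

/-- The quartic (t² − β)(t − r)² has constant term −βr² = −h, so it vanishes at the apex; β < 1
keeps the first factor positive at all nodes. -/
theorem exists_apex_root (hl : 2 ≤ l) {r : ℝ} (hr : apexHeight l < r ^ 2) :
    ∃ β, 0 < β ∧ β < 1 ∧ β * r ^ 2 = apexHeight l := by
  have hp := apexHeight_pos hl
  have hr0 : 0 < r ^ 2 := hp.trans hr
  refine ⟨apexHeight l / r ^ 2, by positivity, by rwa [div_lt_one hr0], div_mul_cancel₀ _ hr0.ne'⟩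

theorem apexHeight_lt_doublePoint : apexHeight l < doublePoint l ^ 2 := by
  unfold apexHeight doublePoint
  have : (0 : ℝ) ≤ l := by positivity
  nlinarith

theorem isFace_apex (hl : 2 ≤ l) : IsFace (vertexVec l) (vertexIdx l) {none} := by
  obtain ⟨β, h0, h1, hβ⟩ := exists_apex_root hl (apexHeight_lt_doublePoint (l := l))
  have hz : -β * doublePoint l ^ 2 + apexHeight l = 0 := by linarith
  refine isFace_of_quartic (by simp [none_mem_vertexIdx]) 0 (-β) (-2 * doublePoint l)
    (doublePoint l ^ 2) hz.ge (by simpa using hz) ?_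
  intro t ht
  have h2 := one_le_sq_of_mem_nodes hl ht
  have h3 := sub_doublePoint_ne_zero (l := l) t
  have e : ((t : ℝ) ^ 2 + 0 * t + -β) * (t ^ 2 + -2 * doublePoint l * t + doublePoint l ^ 2) =
      (t ^ 2 - β) * (t - doublePoint l) ^ 2 := by ring
  have h4 : 0 < (t : ℝ) ^ 2 - β := by linarith
  have hpos : 0 < ((t : ℝ) ^ 2 - β) * (t - doublePoint l) ^ 2 := by positivity
  rw [e]
  exact ⟨hpos.le, by simpa using hpos.ne'⟩

theorem isFace_apex_far (hl : 2 ≤ l) {a : ℤ} (ha : a ∈ nodes l) (hal : 2 * (l : ℤ) ≤ a) :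
    IsFace (vertexVec l) (vertexIdx l) {none, some a} := by
  have hal' : 2 * (l : ℝ) ≤ a := by exact_mod_cast hal
  obtain ⟨β, h0, h1, hβ⟩ := exists_apex_root hl (r := a) (by
    unfold apexHeight
    have : (0 : ℝ) ≤ l := by positivity
    nlinarith)
  have hz : -β * (a : ℝ) ^ 2 + apexHeight l = 0 := by linarith
  refine isFace_of_quartic (by simp [Finset.insert_subset_iff, none_mem_vertexIdx,
    some_mem_vertexIdx, ha]) 0 (-β) (-2 * a) (a ^ 2) hz.ge (by simpa using hz) ?_
  intro t ht
  have h2 := one_le_sq_of_mem_nodes hl ht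
  have e : ((t : ℝ) ^ 2 + 0 * t + -β) * (t ^ 2 + -2 * a * t + a ^ 2) =
      (t ^ 2 - β) * (t - a) ^ 2 := by ring
  have h4 : 0 < (t : ℝ) ^ 2 - β := by linarith
  rw [e]
  refine ⟨by positivity, ?_⟩
  simp [sub_eq_zero, (sub_pos.1 h4).ne']

/-- Since a² = 1, the quartic (t − a)(t + aβ)(t − r)² also has constant term −βr² = −h. The roots a
and −aβ lie in [−1, 1], with only a being a node, and r is the half-integral `doublePoint`. -/
theorem isFace_apex_near (hl : 2 ≤ l) {a : ℤ} (ha : a = 1 ∨ a = -1) :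
    IsFace (vertexVec l) (vertexIdx l) {none, some a} := by
  obtain ⟨β, h0, h1, hβ⟩ := exists_apex_root hl (apexHeight_lt_doublePoint (l := l))
  have hz : -β * doublePoint l ^ 2 + apexHeight l = 0 := by linarith
  have han : a ∈ nodes l := by
    rw [mem_nodes]
    tauto
  refine isFace_of_quartic (by simp [Finset.insert_subset_iff, none_mem_vertexIdx,
    some_mem_vertexIdx, han]) (a * (β - 1)) (-β) (-2 * doublePoint l)
    (doublePoint l ^ 2) hz.ge (by simpa using hz) ?_
  intro t ht
  have h3 := sub_doublePoint_ne_zero (l := l) t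
  have haa : (a : ℝ) ^ 2 = 1 := by rcases ha with rfl | rfl <;> norm_num
  have e : ((t : ℝ) ^ 2 + a * (β - 1) * t + -β) *
      (t ^ 2 + -2 * doublePoint l * t + doublePoint l ^ 2) =
      ((t - a) * (t + a * β)) * (t - doublePoint l) ^ 2 := by
    linear_combination (β * (t - doublePoint l) ^ 2) * haa
  rw [e]
  by_cases hta : t = a
  · subst hta
    simp
  · have hpos : 0 < ((t : ℝ) - a) * (t + a * β) := by
      have hl' : (2 : ℝ) ≤ l := by exact_mod_cast hl
      rcases ha with rfl | rfl <;> rcases mem_nodes.1 ht with rfl | rfl | ⟨h, -⟩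
      · push_cast; nlinarith
      · exact absurd rfl hta
      · have : (l : ℝ) ≤ t := by exact_mod_cast h
        push_cast
        exact mul_pos (by linarith) (by linarith)
      · exact absurd rfl hta
      · push_cast; nlinarith
      · have : (l : ℝ) ≤ t := by exact_mod_cast h
        push_cast
        exact mul_pos (by linarith) (by linarith)
    have hpos' : 0 < (((t : ℝ) - a) * (t + a * β)) * (t - doublePoint l) ^ 2 := by positivity
    exact ⟨hpos'.le, by simpa [hta] using hpos'.ne'⟩

/-- Lagrange interpolation at the nodes `-1, 1, a, a + 1, d`. -/
theorem apex_interpolation {c a₀ a₁ a₂ a₃ h a d : ℝ} {p : ℝ → ℝ}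
    (hp : ∀ t, p t = c + a₀ * t + a₁ * t ^ 2 + a₂ * t ^ 3 + a₃ * t ^ 4) (ha : 1 < a)
    (hd : a + 1 < d) (hpa : p a = 0) :
    c + a₃ * h = (a * (a + 1) * d - h) / (2 * (a - 1) * a * (d - 1)) * p 1 +
      (a * (a + 1) * d + h) / (2 * (a + 1) * (a + 2) * (d + 1)) * p (-1) +
      (a * d - h) / (a * (a + 2) * (d - a - 1)) * p (a + 1) +
      (h - a * (a + 1)) / ((d - 1) * (d + 1) * (d - a) * (d - a - 1)) * p d := by
  have n1 : a - 1 ≠ 0 := by linarith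
  have n2 : a ≠ 0 := by linarith
  have n3 : d - 1 ≠ 0 := by linarith
  have n4 : a + 1 ≠ 0 := by linarith
  have n5 : a + 2 ≠ 0 := by linarith
  have n6 : d + 1 ≠ 0 := by linarith
  have n7 : d - a - 1 ≠ 0 := by linarith
  have n8 : d - a ≠ 0 := by linarith
  have hc : c = -(a₀ * a + a₁ * a ^ 2 + a₂ * a ^ 3 + a₃ * a ^ 4) := by
    rw [hp] at hpa; linarith
  simp only [hp]
  subst hc
  field_simp
  ring

theorem not_isFace_apex (hl : 2 ≤ l) {a : ℤ} (ha : (l : ℤ) ≤ a) (hal : a < 2 * l) :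
    ¬ IsFace (vertexVec l) (vertexIdx l) {none, some a} := by
  rintro ⟨-, φ, hφ⟩
  obtain ⟨c, b, rfl⟩ := exists_eq_affineDual φ
  let p : ℝ → ℝ := fun t => c + b 0 * t + b 1 * t ^ 2 + b 2 * t ^ 3 + b 3 * t ^ 4
  have hval : ∀ t ∈ nodes l, 0 ≤ p t ∧ (p t = 0 ↔ t = a) := by
    intro t ht
    have := hφ (some t) (some_mem_vertexIdx.2 ht)
    rw [vertexVec, affineDual_momentPts_some] at this
    simpa using this
  have hapex : c + b 3 * apexHeight l = 0 := by
    have := (hφ none none_mem_vertexIdx).2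
    rw [vertexVec, affineDual_momentPts_none] at this
    simpa using this
  have hl' : (2 : ℝ) ≤ l := by exact_mod_cast hl
  have ha' : (l : ℝ) ≤ a := by exact_mod_cast ha
  have hal' : (a : ℝ) + 1 ≤ 2 * l := by exact_mod_cast hal
  have hpa : p a = 0 := (hval a (mem_nodes.2 (by omega))).2.2 rfl
  have q1 : 0 < p 1 := by
    have h := hval 1 (mem_nodes.2 (by omega))
    rw [Int.cast_one] at h
    exact lt_of_le_of_ne h.1 fun e => by have := h.2.1 e.symm; omega
  have q2 : 0 ≤ p (-1) := by
    have h := (hval (-1) (mem_nodes.2 (by omega))).1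
    rwa [Int.cast_neg, Int.cast_one] at h
  have q3 : 0 ≤ p (a + 1) := by
    have h := (hval (a + 1) (mem_nodes.2 (by omega))).1
    rwa [Int.cast_add, Int.cast_one] at h
  have q4 : 0 ≤ p (5 * l) := by
    have h := (hval (5 * l) (mem_nodes.2 (by omega))).1
    push_cast at h
    exact h
  -- The left side is the value at the apex, hence zero. On the right all coefficients will be
  -- nonnegative, that of p(1) > 0 strictly positive.
  have key := apex_interpolation (p := p) (h := apexHeight l) (a := a) (d := 5 * l)
    (fun t => rfl) (by linarith) (by linarith) hpa
  rw [hapex] at key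
  -- The last node 5l is far enough that 5la ≥ 5l² > h. In the next line, a ≤ 2l − 1 gives a(a + 1)
  -- ≤ 4l² − 2l < h.
  have m1 : 0 < (a : ℝ) * (5 * l) - apexHeight l := by unfold apexHeight; nlinarith
  have m2 : 0 ≤ apexHeight l - a * (a + 1) := by unfold apexHeight; nlinarith
  have d5 : 0 < (a : ℝ) := by linarith
  have m3 : 0 < (a : ℝ) * (a + 1) * (5 * l) - apexHeight l := by
    have : 0 < (a : ℝ) * a * (5 * l) := by positivity
    nlinarith
  have hp0 := apexHeight_pos hl
  have d1 : 0 < (a : ℝ) - 1 := by linarith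
  have d2 : 0 < 5 * (l : ℝ) - 1 := by linarith
  have d3 : 0 < 5 * (l : ℝ) - a - 1 := by linarith
  have d4 : 0 < 5 * (l : ℝ) - a := by linarith
  have : 0 < ((a : ℝ) * (a + 1) * (5 * l) - apexHeight l) / (2 * (a - 1) * a * (5 * l - 1)) * p 1 +
      (a * (a + 1) * (5 * l) + apexHeight l) / (2 * (a + 1) * (a + 2) * (5 * l + 1)) * p (-1) +
      (a * (5 * l) - apexHeight l) / (a * (a + 2) * (5 * l - a - 1)) * p (a + 1) +
      (apexHeight l - a * (a + 1)) /
        ((5 * l - 1) * (5 * l + 1) * (5 * l - a) * (5 * l - a - 1)) * p (5 * l) := by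
    positivity
  linarith

/-! ### Face numbers of the family -/

theorem card_faces_one_vertexVec (hl : 2 ≤ l) :
    (faces (vertexVec l) (vertexIdx l) 1).card = 4 * l + 4 := by
  rw [faces_vertexVec hl (by norm_num), Finset.filter_eq_self.2, Finset.card_powersetCard,
    Nat.choose_one_right, card_vertexIdx hl]
  intro F hF
  rw [Finset.mem_powersetCard] at hF
  obtain ⟨i, rfl⟩ := Finset.card_eq_one.1 hF.2
  rcases i with _ | t
  · exact isFace_apex hl
  · have := some_mem_vertexIdx.1 (hF.1 (Finset.mem_singleton_self _))
    simpa using isFace_pair hl this this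

theorem not_isFace_pairs (hl : 2 ≤ l) :
    ((Finset.powersetCard 2 (vertexIdx l)).filter
      fun F => ¬ IsFace (vertexVec l) (vertexIdx l) F) =
      (Finset.Ico (l : ℤ) (2 * l)).image fun a => {none, some a} := by
  have hapex : ∀ t ∈ nodes l, ¬ IsFace (vertexVec l) (vertexIdx l) {none, some t} →
      t ∈ Finset.Ico (l : ℤ) (2 * l) := by
    intro t ht h
    rw [Finset.mem_Ico]
    rcases mem_nodes.1 ht with h1 | h1 | h1
    · exact absurd (isFace_apex_near hl (Or.inr h1)) h
    · exact absurd (isFace_apex_near hl (Or.inl h1)) h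
    · exact ⟨h1.1, not_le.1 fun h2 => h (isFace_apex_far hl ht h2)⟩
  ext F
  rw [Finset.mem_filter, Finset.mem_powersetCard, Finset.mem_image]
  constructor
  · rintro ⟨⟨hF, hc⟩, hnot⟩
    obtain ⟨x, y, hxy, rfl⟩ := Finset.card_eq_two.1 hc
    rw [Finset.insert_subset_iff, Finset.singleton_subset_iff] at hF
    rcases x with _ | x <;> rcases y with _ | y
    · exact absurd rfl hxy
    · exact ⟨y, hapex y (some_mem_vertexIdx.1 hF.2) hnot, rfl⟩
    · rw [Finset.pair_comm] at hnot
      exact ⟨x, hapex x (some_mem_vertexIdx.1 hF.1) hnot, Finset.pair_comm _ _⟩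
    · exact absurd (isFace_pair hl (some_mem_vertexIdx.1 hF.1) (some_mem_vertexIdx.1 hF.2)) hnot
  · rintro ⟨a, ha, rfl⟩
    rw [Finset.mem_Ico] at ha
    refine ⟨⟨?_, Finset.card_pair (by simp)⟩, not_isFace_apex hl ha.1 ha.2⟩
    rw [Finset.insert_subset_iff, Finset.singleton_subset_iff, some_mem_vertexIdx, mem_nodes]
    exact ⟨none_mem_vertexIdx, by omega⟩

theorem card_faces_two_vertexVec (hl : 2 ≤ l) :
    (faces (vertexVec l) (vertexIdx l) 2).card = 8 * l ^ 2 + 13 * l + 6 := by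
  have h1 := Finset.card_filter_add_card_filter_not (s := Finset.powersetCard 2 (vertexIdx l))
    (IsFace (vertexVec l) (vertexIdx l))
  rw [not_isFace_pairs hl, ← faces_vertexVec hl (by norm_num), Finset.card_powersetCard,
    card_vertexIdx hl, Finset.card_image_of_injective, Int.card_Ico, Nat.choose_two_right] at h1
  · have h2 : (4 * l + 4) * (4 * l + 4 - 1) = 2 * (8 * l ^ 2 + 14 * l + 6) := by
      rw [show 4 * l + 4 - 1 = 4 * l + 3 by omega]
      ring
    rw [h2] at h1
    omega
  · intro a b e
    have : some a ∈ ({none, some b} : Finset (Option ℤ)) := by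
      rw [← show ({none, some a} : Finset (Option ℤ)) = {none, some b} from e]
      simp
    simpa using this

/-- For simplicial polytopes f₂ = 2(f₁ − f₀), so the 2-faces need not be listed. -/
theorem card_faces_three_vertexVec (hl : 2 ≤ l) :
    (faces (vertexVec l) (vertexIdx l) 3).card = 16 * l ^ 2 + 18 * l + 4 := by
  have h1 := card_faces_one_vertexVec hl
  have h2 := card_faces_two_vertexVec hl
  have hp : IsPointed (vertexVec l) (vertexIdx l) := isPointed_homog _ _
  have h3 := card_faces_three_add_le hp (rank_vertexVec_self hl)
  have h4 := card_faces_three_add_ge hp (rank_vertexVec_self hl) (isSimplicial_vertexVec hl)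
  omega

end Family

end VectorConfig

open VectorConfig in
theorem mem_facePairSet {l : ℕ} (hl : 2 ≤ l) :
    ![8 * (l : ℝ) ^ 2 + 13 * l + 6, 16 * (l : ℝ) ^ 2 + 18 * l + 4] ∈ facePairSet 4 1 2 := by
  have := mem_facePairSet_of_config (rank_vertexVec_self hl)
  rw [show homog (momentPts (apexHeight l)) = vertexVec l from rfl,
    card_faces_two_vertexVec hl, card_faces_three_vertexVec hl] at this
  exact_mod_cast this

/-! ### The set of pairs `(f₁, f₂)` is not semi-algebraic -/

/-- An affine lattice containing four suitable points contains all integer points. -/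
theorem IsAffineLattice.intCast_mem {Λ : Set (Fin 2 → ℝ)} (hΛ : IsAffineLattice Λ)
    (h₁ : ![(64 : ℝ), 104] ∈ Λ) (h₂ : ![(117 : ℝ), 202] ∈ Λ) (h₃ : ![(186 : ℝ), 332] ∈ Λ)
    (h₄ : ![(14 : ℝ), 15] ∈ Λ) (a b : ℤ) : ![(a : ℝ), (b : ℝ)] ∈ Λ := by
  obtain ⟨v, L, -, rfl⟩ := hΛ
  obtain ⟨y₁, hy₁, e₁⟩ := h₁
  obtain ⟨y₂, hy₂, e₂⟩ := h₂
  obtain ⟨y₃, hy₃, e₃⟩ := h₃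
  obtain ⟨y₄, hy₄, e₄⟩ := h₄
  have hp := L.sub_mem hy₂ hy₁
  have hq := L.sub_mem hy₃ hy₂
  have hr := L.sub_mem hy₄ hy₁
  -- The differences are (53, 98), (69, 130) and (−50, −89); this combination is (1, 0) and the next
  -- one is (0, 1).
  have hx : (949 : ℤ) • (y₂ - y₁) - (484 : ℤ) • (y₃ - y₂) + (338 : ℤ) • (y₄ - y₁) ∈ L :=
    L.add_mem (L.sub_mem (L.zsmul_mem hp _) (L.zsmul_mem hq _)) (L.zsmul_mem hr _)
  have hy : (-37 : ℤ) • (y₂ - y₁) + (19 : ℤ) • (y₃ - y₂) - (13 : ℤ) • (y₄ - y₁) ∈ L :=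
    L.sub_mem (L.add_mem (L.zsmul_mem hp _) (L.zsmul_mem hq _)) (L.zsmul_mem hr _)
  refine ⟨_, L.add_mem hy₁ (L.add_mem (L.zsmul_mem hx (a - 64)) (L.zsmul_mem hy (b - 104))), ?_⟩
  have k (i : Fin 2) : y₁ i = ![(64 : ℝ), 104] i - v i ∧ y₂ i = ![(117 : ℝ), 202] i - v i ∧
      y₃ i = ![(186 : ℝ), 332] i - v i ∧ y₄ i = ![(14 : ℝ), 15] i - v i := by
    rw [e₁, e₂, e₃, e₄]
    simp
  ext i
  fin_cases i <;> simp [k] <;> ring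

open Filter in
theorem theorem1p3 : ¬ IsSemialgebraicLatticePointSet (facePairSet 4 1 2) := by
  rintro ⟨S, Λ, hS, hΛ, hA⟩
  have hin : ∀ l : ℕ, 2 ≤ l →
      ![8 * (l : ℝ) ^ 2 + 13 * l + 6, 16 * (l : ℝ) ^ 2 + 18 * l + 4] ∈ S ∩ Λ :=
    fun l hl => hA ▸ mem_facePairSet hl
  have hint : ∀ a b : ℤ, ![(a : ℝ), (b : ℝ)] ∈ Λ := by
    refine hΛ.intCast_mem ?_ ?_ ?_ (hA ▸ bipyramid_mem_facePairSet : _ ∈ S ∩ Λ).2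
    · have := (hin 2 (by norm_num)).2
      norm_num at this
      exact this
    · have := (hin 3 (by norm_num)).2
      norm_num at this
      exact this
    · have := (hin 4 (by norm_num)).2
      norm_num at this
      exact this
  let γ : Fin 2 → Polynomial ℝ :=
    ![8 * .X ^ 2 + 13 * .X + 6, 16 * .X ^ 2 + 18 * .X + 4]
  have hγ : ∀ t : ℝ, (fun i => (γ i).eval t) =
      ![8 * t ^ 2 + 13 * t + 6, 16 * t ^ 2 + 18 * t + 4] := by
    intro t
    ext i
    fin_cases i <;> simp [γ]
  rcases hS.eventuallyDecided γ with h | h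
  · obtain ⟨R, hR⟩ := eventually_atTop.1 h
    obtain ⟨l, hl⟩ := exists_nat_ge R
    -- The shift 3/8 makes both coordinates integral: the fractions combine to 9/8 + 39/8 = 6 and
    -- 9/4 + 27/4 = 9, and the linear terms grow by 6l and 12l.
    have hmem := hR (l + 3 / 8) (by linarith)
    rw [hγ] at hmem
    refine notMem_facePairSet l ?_
    rw [hA]
    refine ⟨?_, ?_⟩
    · convert hmem using 1
      ext i
      fin_cases i <;> simp <;> ring
    · have := hint (8 * l ^ 2 + 19 * l + 12) (16 * l ^ 2 + 30 * l + 13)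
      push_cast at this
      exact this
  · obtain ⟨R, hR⟩ := eventually_atTop.1 h
    obtain ⟨l, hl⟩ := exists_nat_ge (max R 2)
    refine hR l ((le_max_left _ _).trans hl) ?_
    change (fun i => (γ i).eval (l : ℝ)) ∈ S
    rw [hγ]
    exact (hin l (by exact_mod_cast (le_max_right _ _).trans hl)).1
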